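/- Let $\sigma$ be a $d$-dimensional quantum state (a positive semidefinite $d\times d$ complex matrix of trace one) with smallest eigenvalue $\gamma$, and write $\sigma=\sum_{i=1}^d q_i\,|v_i\rangle\langle v_i|$ with an orthonormal eigenbasis $(v_i)$. The Bures $\chi^2$-divergence of a state $\rho$ from $\sigma$ is $$D_{\chi^2}(\rho,\sigma)=\sum_{i,j=1}^d\frac{2}{q_i+q_j}\,\bigl|\langle v_i|(\rho-\sigma)|v_j\rangle\bigr|^2\in[0,\infty],$$ with the conventions $0/0=0$ and $x/0=\infty$ for $x>0$ (it does not depend on the choice of the eigenbasis). For $d$-dimensional states $\rho_1,\dots,\rho_T$ let $\rho_{\mathrm{avg}}=\frac1T\sum_{t=1}^T\rho_t$ and $\varrho=\rho_1\otimes\cdots\otimes\rho_T$. When $\sigma$ has full rank, define on $\mathbb C^d\otimes\mathbb C^d$ the observable $$C=\sum_{i,j=1}^d\frac{2}{q_i+q_j}\,|v_jv_i\rangle\langle v_iv_j|,$$ let $C_{st}$ be $C$ applied to the tensor components $s\neq t$ of $(\mathbb C^d)^{\otimes T}$, and let $$M=\frac{T-1}{T}\Bigl(\operatorname{avg}_{\{s,t\}}C_{st}-\mathrm{Id}\Bigr),$$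 where the average is over the unordered pairs of distinct indices in $\{1,\dots,T\}$ (for $T=1$, $M=0$). **Theorem.** (a) There is a universal constant $K>0$ such that, for all $d$, $T$, $\sigma$ and $\theta\ge 0$ with $$T\ \ge\ K\max\Bigl\{\frac d\theta,\ \frac{\sqrt d}{\sqrt{\theta\gamma}}\Bigr\}$$ (the right side being $\infty$ if $\theta\gamma=0$), measuring $M$ on $\varrho$, i.e. on one copy each of $\rho_1,\dots,\rho_T$, has the following property for all $d$-dimensional states $\rho_1,\dots,\rho_T$: if $D_{\chi^2}(\rho_{\mathrm{avg}},\sigma)\le .99\,\theta$, then the outcome is less than $.995\,\theta$ with probability at least $.99$; and if $D_{\chi^2}(\rho_{\mathrm{avg}},\sigma)>\theta$, then the outcome is at least $.995\,\theta$ with probability at least $.99$. (b) There is a universal constant $K>0$ such that, for all $d$, $T$, every $d$-dimensional state $\sigma$ and every $\epsilon>0$ with $T\ge K\,d/\epsilon^2$, there is a two-outcome measurement (outcomes "close" and "far") on $(\mathbb C^d)^{\otimes T}$, depending only on $d,T,\sigma,\epsilon$, such that for all $d$-dimensional states $\rho_1,\dots,\rho_T$, when it is applied to $\varrho$: if $\rho_{\mathrm{avg}}=\sigma$,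 the outcome is "close" with probability at least $.99$; and if $\frac12\|\rho_{\mathrm{avg}}-\sigma\|_1>\epsilon$, the outcome is "far" with probability at least $.99$. -/

import Mathlib

open scoped ENNReal NNReal Matrix ComplexOrder

noncomputable section

namespace QTest

/-- A `d`-dimensional quantum state: a positive semidefinite `d × d` complex matrix of trace one. -/
structure State (d : ℕ) where
  mat : Matrix (Fin d) (Fin d) ℂ
  psd : mat.PosSemidef
  trace_one : mat.trace = 1

theorem State.herm {d : ℕ} (σ : State d) : σ.mat.IsHermitian := σ.psd.isHermitian

/-- The eigenvalues `q(1), …, q(d)` of a state, with multiplicity. -/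
def State.eig {d : ℕ} (σ : State d) : Fin d → ℝ := σ.herm.eigenvalues

/-- A unitary matrix whose `i`-th column is a unit eigenvector of `σ` for the eigenvalue `q(i)`. -/
def State.basis {d : ℕ} (σ : State d) : Matrix (Fin d) (Fin d) ℂ :=
  (σ.herm.eigenvectorUnitary : Matrix (Fin d) (Fin d) ℂ)

/-- The smallest eigenvalue of `σ`. -/
def State.minEig {d : ℕ} (σ : State d) : ℝ := ⨅ i, σ.eig i

/-- The average `(1/T) ∑ ρ_t`. -/
def avgMat {d T : ℕ} (ρ : Fin T → State d) : Matrix (Fin d) (Fin d) ℂ :=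
  (T : ℂ)⁻¹ • ∑ t, (ρ t).mat

/-- `∑ i j, 2 / (q i + q j) * |Δ i j| ^ 2`, with `0 / 0 = 0` and `x / 0 = ∞` for `x > 0`
(these are the conventions of division in `ℝ≥0∞`). -/
def chiSqDiag {d : ℕ} (q : Fin d → ℝ) (Δ : Matrix (Fin d) (Fin d) ℂ) : ℝ≥0∞ :=
  ∑ i, ∑ j, ENNReal.ofReal (2 * ‖Δ i j‖ ^ 2) / ENNReal.ofReal (q i + q j)

/-- The Bures chi-squared divergence of `ρ` from `σ`: the diagonal formula, applied to
`Δ = ρ - σ` written in an orthonormal eigenbasis of `σ`.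
It does not depend on the eigenbasis, see `buresChiSq_eq`. -/
def buresChiSq {d : ℕ} (ρ : Matrix (Fin d) (Fin d) ℂ) (σ : State d) : ℝ≥0∞ :=
  chiSqDiag σ.eig (σ.basisᴴ * (ρ - σ.mat) * σ.basis)

theorem weightedSum_unitary {d : ℕ} (f : ℝ → ℝ) {q r : Fin d → ℝ}
    {W A : Matrix (Fin d) (Fin d) ℂ} (hW : W * Wᴴ = 1)
    (hqr : ∀ i j, W i j ≠ 0 → r i = q j) :
    ∑ i, ∑ j, f (q i + q j) * ‖(Wᴴ * A * W) i j‖ ^ 2 =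
      ∑ i, ∑ j, f (r i + r j) * ‖A i j‖ ^ 2 := by
  have key : ∀ (p : Fin d → ℝ) (B : Matrix (Fin d) (Fin d) ℂ),
      ((∑ i, ∑ j, f (p i + p j) * ‖B i j‖ ^ 2 : ℝ) : ℂ) =
        (Matrix.of (fun i j => (f (p i + p j) : ℂ) * B i j) * Bᴴ).trace := by
    intro p B
    simp [Matrix.trace, Matrix.mul_apply, mul_assoc, Complex.mul_conj']
  have h : Matrix.of (fun i j => (f (q i + q j) : ℂ) * (Wᴴ * A * W) i j) =
      Wᴴ * Matrix.of (fun i j => (f (r i + r j) : ℂ) * A i j) * W := by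
    ext i j
    simp only [Matrix.of_apply, Matrix.mul_apply, Finset.sum_mul, Finset.mul_sum,
      Matrix.conjTranspose_apply]
    refine Finset.sum_congr rfl fun k _ => Finset.sum_congr rfl fun l _ => ?_
    by_cases h1 : W l i = 0
    · simp [h1]
    by_cases h2 : W k j = 0
    · simp [h2]
    rw [← hqr _ _ h1, ← hqr _ _ h2]
    ring
  have : ((∑ i, ∑ j, f (q i + q j) * ‖(Wᴴ * A * W) i j‖ ^ 2 : ℝ) : ℂ) =
      ((∑ i, ∑ j, f (r i + r j) * ‖A i j‖ ^ 2 : ℝ) : ℂ) := by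
    rw [key, key, h]
    simp only [Matrix.conjTranspose_mul, Matrix.conjTranspose_conjTranspose]
    set G := Matrix.of (fun i j => (f (r i + r j) : ℂ) * A i j)
    calc (Wᴴ * G * W * (Wᴴ * (Aᴴ * W))).trace = (Wᴴ * (G * (W * Wᴴ) * Aᴴ * W)).trace := by
          simp only [Matrix.mul_assoc]
      _ = (G * Aᴴ).trace := by
          rw [hW, Matrix.trace_mul_comm, Matrix.mul_one, Matrix.mul_assoc, hW, Matrix.mul_one]
  exact_mod_cast this

theorem chiSqDiag_split {d : ℕ} (q : Fin d → ℝ) (B : Matrix (Fin d) (Fin d) ℂ) :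
    chiSqDiag q B =
      ENNReal.ofReal (∑ i, ∑ j, (if 0 < q i + q j then 2 / (q i + q j) else 0) * ‖B i j‖ ^ 2) +
      ⊤ * ENNReal.ofReal (∑ i, ∑ j, (if 0 < q i + q j then 0 else 1) * ‖B i j‖ ^ 2) := by
  have n1 : ∀ i j, 0 ≤ (if 0 < q i + q j then 2 / (q i + q j) else 0) * ‖B i j‖ ^ 2 := by
    intro i j; split_ifs <;> positivity
  have n2 : ∀ i j, 0 ≤ (if 0 < q i + q j then (0 : ℝ) else 1) * ‖B i j‖ ^ 2 := by
    intro i j; split_ifs <;> positivity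
  rw [ENNReal.ofReal_sum_of_nonneg fun i _ => Finset.sum_nonneg fun j _ => n1 i j,
    ENNReal.ofReal_sum_of_nonneg fun i _ => Finset.sum_nonneg fun j _ => n2 i j,
    Finset.mul_sum, ← Finset.sum_add_distrib]
  refine Finset.sum_congr rfl fun i _ => ?_
  rw [ENNReal.ofReal_sum_of_nonneg fun j _ => n1 i j,
    ENNReal.ofReal_sum_of_nonneg fun j _ => n2 i j, Finset.mul_sum, ← Finset.sum_add_distrib]
  refine Finset.sum_congr rfl fun j _ => ?_
  by_cases h : 0 < q i + q j
  · simp only [h, if_true, zero_mul, ENNReal.ofReal_zero, mul_zero, add_zero]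
    rw [← ENNReal.ofReal_div_of_pos h]
    congr 1
    ring
  · simp only [h, if_false, zero_mul, ENNReal.ofReal_zero, zero_add, one_mul]
    rw [ENNReal.ofReal_of_nonpos (not_lt.mp h), div_eq_mul_inv, ENNReal.inv_zero, mul_comm,
      ENNReal.ofReal_mul zero_le_two]
    by_cases hB : ENNReal.ofReal (‖B i j‖ ^ 2) = 0
    · simp [hB]
    · rw [ENNReal.top_mul (mul_ne_zero (by simp) hB), ENNReal.top_mul hB]

/-- The diagonal formula gives the same value in every orthonormal eigenbasis of `σ`. -/
theorem buresChiSq_eq {d : ℕ} (ρ : Matrix (Fin d) (Fin d) ℂ) (σ : State d)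
    (U : Matrix (Fin d) (Fin d) ℂ) (hU : U * Uᴴ = 1) (q : Fin d → ℝ)
    (hσ : σ.mat = U * Matrix.diagonal (fun i => (q i : ℂ)) * Uᴴ) :
    buresChiSq ρ σ = chiSqDiag q (Uᴴ * (ρ - σ.mat) * U) := by
  have hV : σ.basis * σ.basisᴴ = 1 := Unitary.mul_star_self_of_mem σ.herm.eigenvectorUnitary.2
  have hV' : σ.basisᴴ * σ.basis = 1 := Unitary.star_mul_self_of_mem σ.herm.eigenvectorUnitary.2
  have hU' : Uᴴ * U = 1 := mul_eq_one_comm.mp hU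
  have hs : σ.mat = σ.basis * Matrix.diagonal (fun i => (σ.eig i : ℂ)) * σ.basisᴴ := by
    have := σ.herm.spectral_theorem
    rw [Unitary.conjStarAlgAut_apply] at this
    exact this
  set V := σ.basis
  have hW : (Vᴴ * U) * (Vᴴ * U)ᴴ = 1 := by
    rw [Matrix.conjTranspose_mul, Matrix.conjTranspose_conjTranspose, Matrix.mul_assoc,
      ← Matrix.mul_assoc U, hU, Matrix.one_mul, hV']
  have hc : Matrix.diagonal (fun i => (σ.eig i : ℂ)) * (Vᴴ * U) =
      (Vᴴ * U) * Matrix.diagonal (fun i => (q i : ℂ)) := by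
    have h1 : Vᴴ * σ.mat * U = Matrix.diagonal (fun i => (σ.eig i : ℂ)) * (Vᴴ * U) := by
      rw [hs]
      calc _ = (Vᴴ * V) * Matrix.diagonal (fun i => (σ.eig i : ℂ)) * (Vᴴ * U) := by
            simp only [Matrix.mul_assoc]
        _ = _ := by rw [hV', Matrix.one_mul]
    have h2 : Vᴴ * σ.mat * U = (Vᴴ * U) * Matrix.diagonal (fun i => (q i : ℂ)) := by
      rw [hσ]
      calc _ = (Vᴴ * U) * Matrix.diagonal (fun i => (q i : ℂ)) * (Uᴴ * U) := by
            simp only [Matrix.mul_assoc]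
        _ = _ := by rw [hU', Matrix.mul_one]
    rw [← h1, h2]
  have hqr : ∀ i j, (Vᴴ * U) i j ≠ 0 → σ.eig i = q j := by
    intro i j hij
    have := congrFun (congrFun hc i) j
    rw [Matrix.diagonal_mul, Matrix.mul_diagonal, mul_comm] at this
    exact_mod_cast mul_left_cancel₀ hij this
  have hB : Uᴴ * (ρ - σ.mat) * U = (Vᴴ * U)ᴴ * (Vᴴ * (ρ - σ.mat) * V) * (Vᴴ * U) := by
    rw [Matrix.conjTranspose_mul, Matrix.conjTranspose_conjTranspose]
    calc _ = Uᴴ * 1 * (ρ - σ.mat) * 1 * U := by simp only [Matrix.mul_one]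
      _ = Uᴴ * (V * Vᴴ) * (ρ - σ.mat) * (V * Vᴴ) * U := by rw [hV]
      _ = _ := by simp only [Matrix.mul_assoc]
  rw [buresChiSq, hB, chiSqDiag_split, chiSqDiag_split,
    weightedSum_unitary (fun x => if 0 < x then 2 / x else 0) hW hqr,
    weightedSum_unitary (fun x => if 0 < x then 0 else 1) hW hqr]

/-- The Schatten 1-norm: the sum of the singular values, i.e. of the square roots of the
eigenvalues of `Aᴴ * A`. -/
def schattenOne {d : ℕ} (A : Matrix (Fin d) (Fin d) ℂ) : ℝ :=
  ∑ i, √((Matrix.isHermitian_conjTranspose_mul_self A).eigenvalues i)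

/-- The trace distance. -/
def traceDist {d : ℕ} (ρ σ : Matrix (Fin d) (Fin d) ℂ) : ℝ := schattenOne (ρ - σ) / 2

/-- Operators on the `T`-fold tensor power of `ℂ^d`; the computational basis is indexed by
the functions `Fin T → Fin d`. -/
abbrev Op (d T : ℕ) : Type := Matrix (Fin T → Fin d) (Fin T → Fin d) ℂ

/-- The product state `ρ_1 ⊗ ⋯ ⊗ ρ_T`. -/
def prodState {d T : ℕ} (ρ : Fin T → State d) : Op d T :=
  Matrix.of fun x y => ∏ t, (ρ t).mat (x t) (y t)

/-- The collision observable `∑ i j, |v_j v_i⟩⟨v_i v_j| / q(i,j)` on `ℂ^d ⊗ ℂ^d`, where `(v_i)` is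
the eigenbasis of `σ` and `q(i,j) = (q(i) + q(j)) / 2`. -/
def collision {d : ℕ} (σ : State d) : Matrix (Fin d × Fin d) (Fin d × Fin d) ℂ :=
  Matrix.of fun a b => ∑ i, ∑ j,
    (((σ.eig i + σ.eig j) / 2 : ℝ) : ℂ)⁻¹ *
      (σ.basis a.1 j * σ.basis a.2 i * (star (σ.basis b.1 i) * star (σ.basis b.2 j)))

/-- The two-body operator `A`, applied to the tensor components `s` and `t` (for `s ≠ t`), and the
identity on the other components. -/
def twoBody {d T : ℕ} (A : Matrix (Fin d × Fin d) (Fin d × Fin d) ℂ) (s t : Fin T) : Op d T :=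
  Matrix.of fun x y =>
    if ∀ u, u ≠ s → u ≠ t → x u = y u then A (x s, x t) (y s, y t) else 0

/-- The observable `M = (T-1)/T * (avg_{s,t} C_{st} - 1)`, the average being over the
`T.choose 2` unordered pairs of distinct indices. -/
def observableM {d : ℕ} (σ : State d) (T : ℕ) : Op d T :=
  (((T : ℝ) - 1) / T) •
    (((T.choose 2 : ℝ)⁻¹ • ∑ s : Fin T, ∑ t ∈ Finset.Ioi s, twoBody (collision σ) s t) - 1)

theorem collision_herm {d : ℕ} (σ : State d) : (collision σ).IsHermitian := by
  ext a b
  simp only [Matrix.conjTranspose_apply, collision, Matrix.of_apply, star_sum]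
  rw [Finset.sum_comm]
  refine Finset.sum_congr rfl fun i _ => Finset.sum_congr rfl fun j _ => ?_
  simp only [star_mul', star_inv₀, Complex.star_def, Complex.conj_ofReal]
  simp only [Complex.conj_conj]
  rw [add_comm (σ.eig j)]
  ring

theorem twoBody_herm {d T : ℕ} {A : Matrix (Fin d × Fin d) (Fin d × Fin d) ℂ}
    (hA : A.IsHermitian) (s t : Fin T) : (twoBody A s t).IsHermitian := by
  ext x y
  have h : (∀ u, u ≠ s → u ≠ t → y u = x u) ↔ (∀ u, u ≠ s → u ≠ t → x u = y u) := by
    simp only [eq_comm]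
  simp only [Matrix.conjTranspose_apply, twoBody, Matrix.of_apply, h]
  split_ifs
  · exact hA.apply _ _
  · simp

theorem observableM_herm {d : ℕ} (σ : State d) (T : ℕ) : (observableM σ T).IsHermitian := by
  have h : (∑ s : Fin T, ∑ t ∈ Finset.Ioi s, twoBody (collision σ) s t).IsHermitian :=
    isSelfAdjoint_sum _ fun s _ => isSelfAdjoint_sum _ fun t _ =>
      twoBody_herm (collision_herm σ) s t
  have h1 : (1 : Op d T).IsHermitian := Matrix.isHermitian_one
  unfold Matrix.IsHermitian at *
  simp [observableM, Matrix.conjTranspose_smul, h, h1]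

/-- The spectral projection of a Hermitian operator `A` onto the span of its eigenvectors with
eigenvalue in `S`. -/
def spectralProj {d T : ℕ} {A : Op d T} (hA : A.IsHermitian) (S : Set ℝ) : Op d T :=
  (hA.eigenvectorUnitary : Op d T) *
    Matrix.diagonal (fun k => S.indicator (fun _ => (1 : ℂ)) (hA.eigenvalues k)) *
    (hA.eigenvectorUnitary : Op d T)ᴴ

/-- The probability that measuring the observable `A` on the state `ϱ` gives an outcome in `S`
(Born rule). -/
def measureProb {d T : ℕ} {A : Op d T} (hA : A.IsHermitian) (ϱ : Op d T) (S : Set ℝ) : ℝ :=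
  (ϱ * spectralProj hA S).trace.re

/-- An algorithm with a binary answer, on input a state of `(ℂ^d)^{⊗T}`: a two-outcome
measurement, with effect `far` for the answer "far" and `1 - far` for the answer "close". -/
structure BinaryTest (d T : ℕ) where
  far : Op d T
  far_nonneg : far.PosSemidef
  far_le_one : (1 - far).PosSemidef

/-- The probability of the answer "far". -/
def BinaryTest.probFar {d T : ℕ} (E : BinaryTest d T) (ϱ : Op d T) : ℝ :=
  (ϱ * E.far).trace.re

/-- The probability of the answer "close". -/
def BinaryTest.probClose {d T : ℕ} (E : BinaryTest d T) (ϱ : Op d T) : ℝ :=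
  (ϱ * (1 - E.far)).trace.re

end QTest

end

/-!
Write all states in the eigenbasis of `σ`, with eigenvalues `q`. Let `L` be entrywise
multiplication by `2 / (q i + q j)` (`chiSchur`), so that `L σ = 1` and `D = tr (Δ (L Δ))` is the
divergence of the average state, with deviation `Δ` from `σ`.

The collision observable on components `s`, `t` is a combination of product operators, so its
moments in a product state factorize: its mean is `tr (ρ_s (L ρ_t))`, its product with a collision
observable sharing only the component `s` has mean `tr (ρ_s (L ρ_t) (L ρ_u))`, and disjoint pairs
are uncorrelated. Hence `M` has mean `D` minus a bias from the missing pairs `s = t`, at most `F / T`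
for `F = tr (σ⁻¹ ρ_avg)`. In the variance, the pairs sharing one component `s` add up to the variance
in `ρ_s` of `∑ t ≠ s, L ρ_t`, which equals `T • (1 + L Δ) - L ρ_s`. This gives (`variance_sumOp_le`)
  `Var M ≤ (8 / T) tr (ρ_avg (L Δ)²) + 10 (F / T)²`.
Since `Δ = (σ (L Δ) + (L Δ) σ) / 2`, Cauchy--Schwarz bounds the first trace by `D + D √(D / γ)`
(`State.trace_deviation_sq_le`), and `F ≤ d + √(D d / γ)` (`State.invTrace_le`). Under the sample size
condition the bias is then a small multiple of `max D θ` and the variance a small multiple of its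
square (`observableM_moments`), and Chebyshev's inequality (`measureProb_ge`) gives the tolerant test.

For the trace distance, each copy is first sent through the channel `ρ ↦ ρ / 2 + 1 / (2 d)`. In the
Heisenberg picture this turns the spectral projection of `M` into the effect of a two-outcome
measurement (`pullback`). The smallest eigenvalue of the depolarized `σ` is at least `1 / (2 d)`, and the
divergence dominates the square of the trace norm (`sq_schattenOne_le`), so the tolerant test applies
with `θ = ε ^ 2`.
-/

noncomputable section

namespace QTest

/-! ### Product operators -/

/-- The product operator `A_1 ⊗ ⋯ ⊗ A_T`. -/
def tens {d T : ℕ} (A : Fin T → Matrix (Fin d) (Fin d) ℂ) : Op d T :=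
  Matrix.of fun x y => ∏ t, A t (x t) (y t)

theorem tens_mul {d T : ℕ} (A B : Fin T → Matrix (Fin d) (Fin d) ℂ) :
    tens A * tens B = tens (A * B) := by
  ext x y
  simp only [tens, Matrix.mul_apply, Matrix.of_apply, Pi.mul_apply, Finset.prod_univ_sum,
    Fintype.piFinset_univ, Finset.prod_mul_distrib]

theorem tens_one {d T : ℕ} : tens (1 : Fin T → Matrix (Fin d) (Fin d) ℂ) = 1 := by
  ext x y
  simp only [tens, Matrix.of_apply, Pi.one_apply, Matrix.one_apply, Finset.prod_ite_zero,
    Finset.prod_const_one, Finset.mem_univ, true_implies, funext_iff]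

theorem trace_tens {d T : ℕ} (A : Fin T → Matrix (Fin d) (Fin d) ℂ) :
    (tens A).trace = ∏ t, (A t).trace := by
  simp only [tens, Matrix.trace, Matrix.diag_apply, Matrix.of_apply, Finset.prod_univ_sum,
    Fintype.piFinset_univ]

theorem tens_conjTranspose {d T : ℕ} (A : Fin T → Matrix (Fin d) (Fin d) ℂ) :
    (tens A)ᴴ = tens (fun t => (A t)ᴴ) := by
  ext x y
  simp [tens, Matrix.conjTranspose_apply]

theorem prodState_eq_tens {d T : ℕ} (ρ : Fin T → State d) :
    prodState ρ = tens (fun t => (ρ t).mat) := rfl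

theorem exists_eq_conjTranspose_mul_self {n : Type*} [Fintype n] [DecidableEq n]
    {A : Matrix n n ℂ} (hA : A.PosSemidef) : ∃ B : Matrix n n ℂ, A = Bᴴ * B := by
  open scoped MatrixOrder Matrix.Norms.L2Operator in
  obtain ⟨B, hB⟩ := CStarAlgebra.nonneg_iff_eq_star_mul_self.mp hA.nonneg
  exact ⟨B, hB⟩

theorem prodState_posSemidef {d T : ℕ} (ρ : Fin T → State d) : (prodState ρ).PosSemidef := by
  choose B hB using fun t => (exists_eq_conjTranspose_mul_self (ρ t).psd)
  have h : prodState ρ = (tens B)ᴴ * tens B := by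
    rw [tens_conjTranspose, tens_mul, prodState_eq_tens]
    congr 1
    exact funext hB
  rw [h]
  exact Matrix.posSemidef_conjTranspose_mul_self _

theorem trace_prodState {d T : ℕ} (ρ : Fin T → State d) : (prodState ρ).trace = 1 := by
  rw [prodState_eq_tens, trace_tens]
  simp [State.trace_one]

/-- The operator `E` acting on the tensor component `s`. -/
def siteOp {d T : ℕ} (s : Fin T) (E : Matrix (Fin d) (Fin d) ℂ) : Op d T :=
  tens (Pi.mulSingle s E)

theorem siteOp_mul_siteOp {d T : ℕ} (s t : Fin T) (E F : Matrix (Fin d) (Fin d) ℂ) :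
    siteOp s E * siteOp t F = tens (Pi.mulSingle s E * Pi.mulSingle t F) := tens_mul _ _

theorem siteOp_comm {d T : ℕ} {s t : Fin T} (h : s ≠ t) (E F : Matrix (Fin d) (Fin d) ℂ) :
    siteOp s E * siteOp t F = siteOp t F * siteOp s E := by
  rw [siteOp_mul_siteOp, siteOp_mul_siteOp, (Pi.mulSingle_commute (f := fun _ : Fin T => Matrix (Fin d) (Fin d) ℂ) h E F).eq]

/-- A two-body operator built from a product operator is a product of one-body operators. -/
theorem twoBody_kronecker {d T : ℕ} {s t : Fin T} (h : s ≠ t) (E F : Matrix (Fin d) (Fin d) ℂ) :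
    twoBody (Matrix.of fun a b : Fin d × Fin d => E a.1 b.1 * F a.2 b.2) s t =
      siteOp s E * siteOp t F := by
  rw [siteOp_mul_siteOp]
  ext x y
  simp only [twoBody, tens, Matrix.of_apply, Pi.mul_apply]
  have key : ∀ u, ((Pi.mulSingle s E : Fin T → Matrix (Fin d) (Fin d) ℂ) u *
      (Pi.mulSingle t F : Fin T → Matrix (Fin d) (Fin d) ℂ) u) (x u) (y u) =
      (if u = s then E (x s) (y s) else 1) * (if u = t then F (x t) (y t) else 1) *
        (if u ≠ s → u ≠ t → x u = y u then 1 else 0) := by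
    intro u
    by_cases h1 : u = s
    · subst h1
      simp [h]
    · by_cases h2 : u = t
      · subst h2
        simp [h1]
      · simp [h1, h2, Matrix.one_apply]
  rw [Finset.prod_congr rfl fun u _ => key u, Finset.prod_mul_distrib, Finset.prod_mul_distrib,
    Finset.prod_ite_zero]
  simp

/-- The expectation of a product operator in a product state factorizes. -/
theorem trace_prodState_mul_tens {d T : ℕ} (ρ : Fin T → State d)
    (A : Fin T → Matrix (Fin d) (Fin d) ℂ) :
    (prodState ρ * tens A).trace = ∏ t, ((ρ t).mat * A t).trace := by
  rw [prodState_eq_tens, tens_mul, trace_tens]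
  rfl

theorem trace_prodState_mul_siteOp_mul_tens {d T : ℕ} (ρ : Fin T → State d) (t : Fin T)
    (F : Matrix (Fin d) (Fin d) ℂ) (A : Fin T → Matrix (Fin d) (Fin d) ℂ) (hA : A t = 1) :
    (prodState ρ * (siteOp t F * tens A)).trace =
      ((ρ t).mat * F).trace * (prodState ρ * tens A).trace := by
  rw [siteOp, tens_mul, trace_prodState_mul_tens, trace_prodState_mul_tens,
    ← Finset.mul_prod_erase _ _ (Finset.mem_univ t),
    ← Finset.mul_prod_erase Finset.univ (fun u => ((ρ u).mat * A u).trace) (Finset.mem_univ t)]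
  simp only [Pi.mul_apply, Pi.mulSingle_eq_same, hA, Matrix.mul_one, State.trace_one, one_mul]
  congr 1
  refine Finset.prod_congr rfl fun u hu => ?_
  rw [Pi.mulSingle_eq_of_ne (Finset.ne_of_mem_erase hu), one_mul]

theorem trace_prodState_mul_siteOp {d T : ℕ} (ρ : Fin T → State d) (s : Fin T)
    (E : Matrix (Fin d) (Fin d) ℂ) :
    (prodState ρ * siteOp s E).trace = ((ρ s).mat * E).trace := by
  have := trace_prodState_mul_siteOp_mul_tens ρ s E 1 rfl
  rwa [tens_one, mul_one, mul_one, trace_prodState, mul_one] at this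

theorem trace_two_sites {d T : ℕ} (ρ : Fin T → State d) {s t : Fin T} (h : s ≠ t)
    (E F : Matrix (Fin d) (Fin d) ℂ) :
    (prodState ρ * (siteOp s E * siteOp t F)).trace =
      ((ρ s).mat * E).trace * ((ρ t).mat * F).trace := by
  conv_lhs => rw [siteOp.eq_1 t F]
  rw [trace_prodState_mul_siteOp_mul_tens _ _ _ _ (Pi.mulSingle_eq_of_ne h _), ← siteOp.eq_1,
    trace_prodState_mul_siteOp]

theorem trace_three_sites {d T : ℕ} (ρ : Fin T → State d) {s t u : Fin T} (hst : s ≠ t)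
    (hsu : s ≠ u) (htu : t ≠ u) (E F G : Matrix (Fin d) (Fin d) ℂ) :
    (prodState ρ * (siteOp s E * (siteOp t F * siteOp u G))).trace =
      ((ρ s).mat * E).trace * (((ρ t).mat * F).trace * ((ρ u).mat * G).trace) := by
  rw [siteOp_mul_siteOp t u, trace_prodState_mul_siteOp_mul_tens, ← siteOp_mul_siteOp,
    trace_two_sites ρ htu]
  simp [Pi.mulSingle_eq_of_ne hst, Pi.mulSingle_eq_of_ne hsu]

theorem trace_four_sites {d T : ℕ} (ρ : Fin T → State d) {s t u v : Fin T} (hst : s ≠ t)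
    (hsu : s ≠ u) (hsv : s ≠ v) (htu : t ≠ u) (htv : t ≠ v) (huv : u ≠ v)
    (E F G H : Matrix (Fin d) (Fin d) ℂ) :
    (prodState ρ * (siteOp s E * (siteOp t F * (siteOp u G * siteOp v H)))).trace =
      ((ρ s).mat * E).trace * (((ρ t).mat * F).trace *
        (((ρ u).mat * G).trace * ((ρ v).mat * H).trace)) := by
  rw [siteOp_mul_siteOp u v, siteOp.eq_1 t, tens_mul, trace_prodState_mul_siteOp_mul_tens,
    ← tens_mul, ← siteOp_mul_siteOp, ← siteOp.eq_1, trace_three_sites ρ htu htv huv]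
  simp [Pi.mulSingle_eq_of_ne hst, Pi.mulSingle_eq_of_ne hsu, Pi.mulSingle_eq_of_ne hsv]

theorem siteOp_mul_siteOp_same {d T : ℕ} (s : Fin T) (E F : Matrix (Fin d) (Fin d) ℂ) :
    siteOp s E * siteOp s F = siteOp s (E * F) := by
  rw [siteOp_mul_siteOp, ← Pi.mulSingle_mul, siteOp]

/-! ### Moments of the collision observable -/

/-- The weight `2 / (q i + q j)` of the Bures chi-squared divergence. -/
def chiWeight {d : ℕ} (q : Fin d → ℝ) (i j : Fin d) : ℝ := ((q i + q j) / 2)⁻¹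

theorem chiWeight_comm {d : ℕ} (q : Fin d → ℝ) (i j : Fin d) :
    chiWeight q i j = chiWeight q j i := by
  rw [chiWeight, chiWeight, add_comm]

/-- Entrywise multiplication by the weights `2 / (q i + q j)`. For `q > 0` it inverts the map
`X ↦ (D X + X D) / 2`, where `D` is the diagonal matrix of `q`. -/
def chiSchur {d : ℕ} (q : Fin d → ℝ) (X : Matrix (Fin d) (Fin d) ℂ) : Matrix (Fin d) (Fin d) ℂ :=
  Matrix.of fun i j => (chiWeight q i j : ℂ) * X i j

theorem State.basis_mul_conjTranspose {d : ℕ} (σ : State d) : σ.basis * σ.basisᴴ = 1 :=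
  Unitary.mul_star_self_of_mem σ.herm.eigenvectorUnitary.2

theorem State.conjTranspose_mul_basis {d : ℕ} (σ : State d) : σ.basisᴴ * σ.basis = 1 :=
  Unitary.star_mul_self_of_mem σ.herm.eigenvectorUnitary.2

/-- The state `ρ`, written in the eigenbasis of `σ`. -/
def State.inBasis {d : ℕ} (ρ σ : State d) : State d where
  mat := σ.basisᴴ * ρ.mat * σ.basis
  psd := ρ.psd.conjTranspose_mul_mul_same _
  trace_one := by
    rw [Matrix.trace_mul_comm, ← Matrix.mul_assoc, σ.basis_mul_conjTranspose, Matrix.one_mul,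
      ρ.trace_one]

/-- The operator `|v_i⟩⟨v_j|`, where `(v_i)` is the eigenbasis of `σ`. -/
def State.unit {d : ℕ} (σ : State d) (i j : Fin d) : Matrix (Fin d) (Fin d) ℂ :=
  σ.basis * Matrix.single i j 1 * σ.basisᴴ

theorem State.unit_apply {d : ℕ} (σ : State d) (i j x y : Fin d) :
    σ.unit i j x y = σ.basis x i * star (σ.basis y j) := by
  simp [State.unit, Matrix.mul_apply, Matrix.single_apply, ite_and, Finset.sum_ite_eq]

theorem State.unit_mul_unit {d : ℕ} (σ : State d) (i j k l : Fin d) :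
    σ.unit i j * σ.unit k l = if j = k then σ.unit i l else 0 := by
  have h : σ.unit i j * σ.unit k l =
      σ.basis * (Matrix.single i j 1 * ((σ.basisᴴ * σ.basis) * Matrix.single k l 1)) * σ.basisᴴ := by
    simp only [State.unit, Matrix.mul_assoc]
  rw [h, σ.conjTranspose_mul_basis, Matrix.one_mul]
  split_ifs with hjk
  · subst hjk
    simp [State.unit]
  · rw [Matrix.single_mul_single_of_ne (h := hjk)]
    simp

theorem State.trace_mul_unit {d : ℕ} (ρ σ : State d) (i j : Fin d) :
    (ρ.mat * σ.unit i j).trace = (ρ.inBasis σ).mat j i := by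
  have h : (ρ.mat * σ.unit i j).trace = ((ρ.inBasis σ).mat * Matrix.single i j 1).trace := by
    simp only [State.unit, State.inBasis]
    rw [← Matrix.mul_assoc, Matrix.trace_mul_comm]
    simp only [Matrix.mul_assoc]
  rw [h, Matrix.trace_mul_single]
  simp

/-- The collision observable on two distinct components; zero on the diagonal `s = t`. -/
def pairOp {d T : ℕ} (σ : State d) (s t : Fin T) : Op d T :=
  if s = t then 0 else twoBody (collision σ) s t

theorem pairOp_self {d T : ℕ} (σ : State d) (s : Fin T) : pairOp σ s s = 0 := if_pos rfl

theorem pairOp_of_ne {d T : ℕ} (σ : State d) {s t : Fin T} (h : s ≠ t) :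
    pairOp σ s t = ∑ i, ∑ j, (chiWeight σ.eig i j : ℂ) •
      (siteOp s (σ.unit j i) * siteOp t (σ.unit i j)) := by
  rw [pairOp, if_neg h]
  simp only [← twoBody_kronecker h]
  ext x y
  simp only [twoBody, collision, Matrix.of_apply, Matrix.sum_apply, Matrix.smul_apply,
    State.unit_apply, smul_eq_mul, mul_ite, mul_zero]
  by_cases hxy : ∀ u, u ≠ s → u ≠ t → x u = y u
  · simp only [if_pos hxy]
    refine Finset.sum_congr rfl fun i _ => Finset.sum_congr rfl fun j _ => ?_
    simp only [chiWeight]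
    push_cast
    ring
  · simp [if_neg hxy]

theorem pairOp_comm {d T : ℕ} (σ : State d) (s t : Fin T) : pairOp σ s t = pairOp σ t s := by
  by_cases h : s = t
  · rw [h]
  · rw [pairOp_of_ne σ h, pairOp_of_ne σ (Ne.symm h), Finset.sum_comm]
    refine Finset.sum_congr rfl fun i _ => Finset.sum_congr rfl fun j _ => ?_
    rw [chiWeight_comm, siteOp_comm h]

theorem trace_pairOp {d T : ℕ} (ρ : Fin T → State d) (σ : State d) {s t : Fin T} (h : s ≠ t) :
    (prodState ρ * pairOp σ s t).trace =
      (((ρ s).inBasis σ).mat * chiSchur σ.eig ((ρ t).inBasis σ).mat).trace := by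
  simp only [pairOp_of_ne σ h, Finset.mul_sum, Matrix.trace_sum, Matrix.mul_smul,
    Matrix.trace_smul, trace_two_sites ρ h, State.trace_mul_unit, smul_eq_mul]
  simp only [Matrix.trace, Matrix.diag_apply, Matrix.mul_apply, chiSchur, Matrix.of_apply]
  refine Finset.sum_congr rfl fun i _ => Finset.sum_congr rfl fun j _ => ?_
  rw [chiWeight_comm]
  ring

/-- Two collision observables that share the component `s`: the other two components act on `s`
through the effective one-body operators `chiSchur q ρ_t` and `chiSchur q ρ_u`. -/
theorem trace_pairOp_mul_pairOp_shared {d T : ℕ} (ρ : Fin T → State d) (σ : State d)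
    {s t u : Fin T} (hst : s ≠ t) (hsu : s ≠ u) (htu : t ≠ u) :
    (prodState ρ * (pairOp σ s t * pairOp σ s u)).trace =
      (((ρ s).inBasis σ).mat * (chiSchur σ.eig ((ρ t).inBasis σ).mat *
        chiSchur σ.eig ((ρ u).inBasis σ).mat)).trace := by
  have key : ∀ E F G H : Matrix (Fin d) (Fin d) ℂ,
      siteOp s E * siteOp t F * (siteOp s G * siteOp u H) =
        siteOp s (E * G) * (siteOp t F * siteOp u H) := by
    intro E F G H
    rw [mul_assoc, ← mul_assoc (siteOp t F), siteOp_comm hst.symm, mul_assoc (siteOp s G),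
      ← mul_assoc, siteOp_mul_siteOp_same]
  simp only [pairOp_of_ne σ hst, pairOp_of_ne σ hsu, Finset.mul_sum, Finset.sum_mul,
    Matrix.trace_sum, Matrix.mul_smul, Matrix.smul_mul,
    Matrix.trace_smul, key, trace_three_sites ρ hst hsu htu, State.unit_mul_unit, smul_eq_mul,
    State.trace_mul_unit, mul_ite, ite_mul, apply_ite Matrix.trace,
    Matrix.trace_zero, zero_mul, mul_zero, Finset.sum_ite_irrel, Finset.sum_const_zero,
    Finset.sum_ite_eq', Finset.mem_univ, if_true]
  simp only [Matrix.trace, Matrix.diag_apply, Matrix.mul_apply, chiSchur, Matrix.of_apply,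
    Finset.mul_sum]
  refine Finset.sum_congr rfl fun i _ => ?_
  rw [Finset.sum_comm]
  refine Finset.sum_congr rfl fun j _ => Finset.sum_congr rfl fun k _ => ?_
  rw [chiWeight_comm _ i k, chiWeight_comm _ k j]
  ring

/-- The square of the collision observable is diagonal in the product eigenbasis, so only the
diagonals of the two states enter. -/
theorem trace_pairOp_sq {d T : ℕ} (ρ : Fin T → State d) (σ : State d)
    {s t : Fin T} (hst : s ≠ t) :
    (prodState ρ * (pairOp σ s t * pairOp σ s t)).trace =
      ∑ i, ∑ j, (chiWeight σ.eig i j : ℂ) ^ 2 *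
        (((ρ s).inBasis σ).mat i i * ((ρ t).inBasis σ).mat j j) := by
  have key : ∀ E F G H : Matrix (Fin d) (Fin d) ℂ,
      siteOp s E * siteOp t F * (siteOp s G * siteOp t H) =
        siteOp s (E * G) * siteOp t (F * H) := by
    intro E F G H
    rw [mul_assoc, ← mul_assoc (siteOp t F), siteOp_comm hst.symm, mul_assoc (siteOp s G),
      ← mul_assoc, siteOp_mul_siteOp_same, siteOp_mul_siteOp_same]
  simp only [pairOp_of_ne σ hst, Finset.mul_sum, Finset.sum_mul,
    Matrix.trace_sum, Matrix.mul_smul, Matrix.smul_mul,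
    Matrix.trace_smul, key, trace_two_sites ρ hst, State.unit_mul_unit, smul_eq_mul,
    State.trace_mul_unit, mul_ite, ite_mul, apply_ite Matrix.trace,
    Matrix.trace_zero, zero_mul, mul_zero,
    Finset.sum_ite_eq', Finset.mem_univ, if_true]
  refine Finset.sum_congr rfl fun i _ => Finset.sum_congr rfl fun j _ => ?_
  rw [chiWeight_comm _ j i]
  ring

theorem trace_pairOp_mul_pairOp_disjoint {d T : ℕ} (ρ : Fin T → State d) (σ : State d)
    {s t u v : Fin T} (hst : s ≠ t) (hsu : s ≠ u) (hsv : s ≠ v) (htu : t ≠ u) (htv : t ≠ v)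
    (huv : u ≠ v) :
    (prodState ρ * (pairOp σ s t * pairOp σ u v)).trace =
      (prodState ρ * pairOp σ s t).trace * (prodState ρ * pairOp σ u v).trace := by
  simp only [pairOp_of_ne σ hst, pairOp_of_ne σ huv, Finset.mul_sum, Finset.sum_mul,
    Matrix.trace_sum, Matrix.mul_smul, Matrix.smul_mul, mul_assoc,
    Matrix.trace_smul, trace_two_sites ρ hst, trace_two_sites ρ huv, smul_eq_mul,
    trace_four_sites ρ hst hsu hsv htu htv huv]
  refine Finset.sum_congr rfl fun i _ => Finset.sum_congr rfl fun j _ =>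
    Finset.sum_congr rfl fun k _ => Finset.sum_congr rfl fun l _ => ?_
  ring

/-- In a sum over two ordered pairs of a function that is symmetric within each pair, vanishes on
degenerate pairs, and vanishes on disjoint pairs, only overlapping pairs remain. -/
theorem sum_overlapping_pairs {ι : Type*} [Fintype ι] [DecidableEq ι] (G : ι → ι → ι → ι → ℝ)
    (h1 : ∀ s t a b, G s t a b = G t s a b) (h2 : ∀ s t a b, G s t a b = G s t b a)
    (h3 : ∀ s a b, G s s a b = 0) (h4 : ∀ s t a, G s t a a = 0)
    (h5 : ∀ s t a b, s ≠ t → s ≠ a → s ≠ b → t ≠ a → t ≠ b → a ≠ b → G s t a b = 0) :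
    ∑ s, ∑ t, ∑ a, ∑ b, G s t a b =
      4 * ∑ s, ∑ t, ∑ u, G s t s u - 2 * ∑ s, ∑ t, G s t s t := by
  have key : ∀ s t, ∑ a, ∑ b, G s t a b =
      2 * ∑ b, G s t s b + 2 * ∑ b, G s t t b - 2 * G s t s t := by
    intro s t
    by_cases hst : s = t
    · subst hst
      simp [h3]
    -- inclusion-exclusion over which of `a`, `b` lies in `{s, t}`
    have hp : ∀ a b, G s t a b = (if a = s then G s t a b else 0) + (if a = t then G s t a b else 0)
        + (if b = s then G s t a b else 0) + (if b = t then G s t a b else 0)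
        - (if a = s then if b = t then G s t a b else 0 else 0)
        - (if a = t then if b = s then G s t a b else 0 else 0) := by
      intro a b
      by_cases hab : a = b
      · subst hab; simp [h4]
      have := h5 s t a b hst
      grind
    rw [Finset.sum_congr rfl fun a _ => Finset.sum_congr rfl fun b _ => hp a b]
    simp only [Finset.sum_sub_distrib, Finset.sum_add_distrib, Finset.sum_ite_eq', Finset.mem_univ,
      if_true, Finset.sum_ite_irrel, Finset.sum_const_zero]
    rw [Finset.sum_congr rfl fun a _ => h2 s t a s, Finset.sum_congr rfl fun a _ => h2 s t a t,
      h2 s t t s]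
    ring
  have hsw : ∑ s, ∑ t, ∑ b, G s t t b = ∑ s, ∑ t, ∑ b, G s t s b := by
    rw [Finset.sum_comm]
    exact Finset.sum_congr rfl fun s _ => Finset.sum_congr rfl fun t _ =>
      Finset.sum_congr rfl fun b _ => h1 t s s b
  simp only [key, Finset.sum_sub_distrib, Finset.sum_add_distrib, ← Finset.mul_sum, hsw]
  ring

/-! ### Expectations and variances in a single state -/

theorem State.trace_sq_nonneg {d : ℕ} (R : State d) {Z : Matrix (Fin d) (Fin d) ℂ}
    (hZ : Z.IsHermitian) : 0 ≤ (R.mat * (Z * Z)).trace.re := by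
  have h := (R.psd.mul_mul_conjTranspose_same Z).trace_nonneg
  rw [hZ.eq, Matrix.trace_mul_comm, ← Matrix.mul_assoc, Matrix.trace_mul_comm] at h
  exact (Complex.le_def.mp h).1

theorem State.sq_trace_le {d : ℕ} (R : State d) {Z : Matrix (Fin d) (Fin d) ℂ}
    (hZ : Z.IsHermitian) : (R.mat * Z).trace.re ^ 2 ≤ (R.mat * (Z * Z)).trace.re := by
  -- expand `0 ≤ E[(Z - m)²]` for the mean `m`
  set m := (R.mat * Z).trace.re with hm
  have hmH : ((m : ℂ) • (1 : Matrix (Fin d) (Fin d) ℂ)).IsHermitian := by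
    simp [Matrix.IsHermitian, Matrix.conjTranspose_smul]
  have h := R.trace_sq_nonneg (hZ.sub hmH)
  simp only [sub_mul, mul_sub, Matrix.mul_smul, Matrix.smul_mul, Matrix.mul_one, Matrix.one_mul,
    Matrix.trace_sub, Matrix.trace_smul, R.trace_one, smul_eq_mul, Complex.sub_re,
    Complex.re_ofReal_mul, ← hm] at h
  simp at h
  nlinarith

/-- The variance of `c + A - B` is at most `2 E[A²] + 2 E[B²]`. -/
theorem State.variance_le {d : ℕ} (R : State d) (c : ℝ) {Y A B : Matrix (Fin d) (Fin d) ℂ}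
    (hA : A.IsHermitian) (hB : B.IsHermitian) (hY : Y = (c : ℂ) • 1 + (A - B)) :
    (R.mat * (Y * Y)).trace.re - (R.mat * Y).trace.re ^ 2 ≤
      2 * (R.mat * (A * A)).trace.re + 2 * (R.mat * (B * B)).trace.re := by
  -- `E[(A - B)²] + E[(A + B)²] = 2 E[A²] + 2 E[B²]`
  have h := R.trace_sq_nonneg (hA.add hB)
  subst hY
  simp only [sub_mul, mul_sub, mul_add, add_mul, Matrix.mul_smul, Matrix.smul_mul, Matrix.mul_one,
    Matrix.one_mul, Matrix.trace_add, Matrix.trace_sub, Matrix.trace_smul, R.trace_one,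
    smul_eq_mul, Complex.sub_re, Complex.add_re, Complex.re_ofReal_mul] at h ⊢
  simp
  nlinarith [sq_nonneg ((R.mat * A).trace.re - (R.mat * B).trace.re)]

/-- The diagonal of a state, i.e. the outcome distribution of a measurement in the given basis. -/
def State.diag {d : ℕ} (R : State d) (i : Fin d) : ℝ := (R.mat i i).re

theorem State.diag_nonneg {d : ℕ} (R : State d) (i : Fin d) : 0 ≤ R.diag i :=
  (Complex.le_def.mp (R.psd.diag_nonneg (i := i))).1

theorem State.ofReal_diag {d : ℕ} (R : State d) (i : Fin d) : (R.diag i : ℂ) = R.mat i i := by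
  have := R.herm.apply i i
  rw [Complex.star_def, Complex.conj_eq_iff_re] at this
  exact this

theorem State.sum_diag {d : ℕ} (R : State d) : ∑ i, R.diag i = 1 := by
  have := congrArg Complex.re R.trace_one
  simpa [Matrix.trace, State.diag] using this

theorem State.norm_sq_le {d : ℕ} (R : State d) (i j : Fin d) :
    ‖R.mat i j‖ ^ 2 ≤ R.diag i * R.diag j := by
  have h := (R.psd.submatrix ![i, j]).det_nonneg
  rw [Matrix.det_fin_two] at h
  simp only [Matrix.submatrix_apply, Matrix.cons_val_zero, Matrix.cons_val_one] at h
  rw [← R.herm.apply j i, Complex.star_def, Complex.mul_conj', ← R.ofReal_diag,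
    ← R.ofReal_diag] at h
  have := (Complex.le_def.mp h).1
  norm_cast at this
  simp at this
  linarith

/-! ### Weighted bounds -/

theorem chiWeight_pos {d : ℕ} {q : Fin d → ℝ} (hq : ∀ i, 0 < q i) (i j : Fin d) :
    0 < chiWeight q i j := by
  have := hq i
  have := hq j
  unfold chiWeight
  positivity

/-- The harmonic mean of `q i` and `q j` is at most their arithmetic mean. -/
theorem chiWeight_le {d : ℕ} {q : Fin d → ℝ} (hq : ∀ i, 0 < q i) (i j : Fin d) :
    chiWeight q i j ≤ ((q i)⁻¹ + (q j)⁻¹) / 2 := by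
  have h1 := hq i
  have h2 := hq j
  rw [chiWeight, inv_le_iff_one_le_mul₀ (by positivity)]
  have : (q i + q j) / 2 * (((q i)⁻¹ + (q j)⁻¹) / 2) - 1 =
      (q i - q j) ^ 2 / (4 * (q i * q j)) := by
    field_simp
    ring
  have : 0 ≤ (q i - q j) ^ 2 / (4 * (q i * q j)) := by positivity
  linarith

theorem chiWeight_sq_le {d : ℕ} {q : Fin d → ℝ} (hq : ∀ i, 0 < q i) (i j : Fin d) :
    chiWeight q i j ^ 2 ≤ (q i)⁻¹ * (q j)⁻¹ := by
  have h1 := hq i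
  have h2 := hq j
  rw [chiWeight, ← mul_inv, inv_pow]
  apply inv_anti₀ (by positivity)
  nlinarith [sq_nonneg (q i - q j)]

theorem chiSchur_isHermitian {d : ℕ} (q : Fin d → ℝ) {X : Matrix (Fin d) (Fin d) ℂ}
    (hX : X.IsHermitian) : (chiSchur q X).IsHermitian := by
  ext i j
  simp only [Matrix.conjTranspose_apply, chiSchur, Matrix.of_apply, star_mul', Complex.star_def,
    Complex.conj_ofReal, chiWeight_comm q j i]
  rw [← hX.apply i j, Complex.star_def]

theorem chiSchur_add {d : ℕ} (q : Fin d → ℝ) (X Y : Matrix (Fin d) (Fin d) ℂ) :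
    chiSchur q (X + Y) = chiSchur q X + chiSchur q Y := by
  ext; simp [chiSchur, mul_add]

theorem chiSchur_sum {d : ℕ} {ι : Type*} (s : Finset ι) (q : Fin d → ℝ)
    (X : ι → Matrix (Fin d) (Fin d) ℂ) :
    chiSchur q (∑ a ∈ s, X a) = ∑ a ∈ s, chiSchur q (X a) := by
  ext; simp [chiSchur, Matrix.sum_apply, Finset.mul_sum]

theorem chiSchur_smul {d : ℕ} (q : Fin d → ℝ) (c : ℂ) (X : Matrix (Fin d) (Fin d) ℂ) :
    chiSchur q (c • X) = c • chiSchur q X := by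
  ext; simp [chiSchur]; ring

theorem chiSchur_diagonal {d : ℕ} {q : Fin d → ℝ} (hq : ∀ i, 0 < q i) :
    chiSchur q (Matrix.diagonal fun i => (q i : ℂ)) = 1 := by
  ext i j
  by_cases h : i = j
  · subst h
    have := (hq i).ne'
    simp only [chiSchur, chiWeight, Matrix.of_apply, Matrix.diagonal_apply_eq, Matrix.one_apply_eq]
    norm_cast
    field_simp
    norm_num
  · simp [chiSchur, h]

/-- The weighted squared Hilbert--Schmidt norm `∑ i j, 2 / (q i + q j) * |X i j| ^ 2`. -/
def chiNorm {d : ℕ} (q : Fin d → ℝ) (X : Matrix (Fin d) (Fin d) ℂ) : ℝ :=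
  ∑ i, ∑ j, chiWeight q i j * ‖X i j‖ ^ 2

theorem chiNorm_nonneg {d : ℕ} {q : Fin d → ℝ} (hq : ∀ i, 0 < q i)
    (X : Matrix (Fin d) (Fin d) ℂ) : 0 ≤ chiNorm q X :=
  Finset.sum_nonneg fun i _ => Finset.sum_nonneg fun j _ =>
    mul_nonneg (chiWeight_pos hq i j).le (sq_nonneg _)

theorem trace_mul_chiSchur {d : ℕ} (q : Fin d → ℝ) {X : Matrix (Fin d) (Fin d) ℂ}
    (hX : X.IsHermitian) : (X * chiSchur q X).trace = (chiNorm q X : ℂ) := by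
  simp only [Matrix.trace, Matrix.diag_apply, Matrix.mul_apply, chiSchur, Matrix.of_apply, chiNorm]
  push_cast
  refine Finset.sum_congr rfl fun i _ => Finset.sum_congr rfl fun j _ => ?_
  rw [← hX.apply j i, ← Complex.mul_conj', chiWeight_comm, Complex.star_def]
  ring

/-- The trace of `σ⁻¹ R`, where `σ` is the diagonal matrix of `q`. -/
def State.invTrace {d : ℕ} (R : State d) (q : Fin d → ℝ) : ℝ := ∑ i, R.diag i * (q i)⁻¹

theorem State.invTrace_nonneg {d : ℕ} (R : State d) {q : Fin d → ℝ} (hq : ∀ i, 0 < q i) :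
    0 ≤ R.invTrace q :=
  Finset.sum_nonneg fun i _ => mul_nonneg (R.diag_nonneg i) (inv_nonneg.mpr (hq i).le)

/-- `|R i j| ^ 2 ≤ R i i * R j j` and the harmonic-arithmetic mean inequality reduce the weighted
norm of a state to its diagonal. -/
theorem State.chiNorm_le_invTrace {d : ℕ} (R : State d) {q : Fin d → ℝ} (hq : ∀ i, 0 < q i) :
    chiNorm q R.mat ≤ R.invTrace q := by
  calc chiNorm q R.mat
      ≤ ∑ i, ∑ j, ((q i)⁻¹ + (q j)⁻¹) / 2 * (R.diag i * R.diag j) := by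
        refine Finset.sum_le_sum fun i _ => Finset.sum_le_sum fun j _ => ?_
        exact mul_le_mul (chiWeight_le hq i j) (R.norm_sq_le i j) (sq_nonneg _)
          ((chiWeight_pos hq i j).le.trans (chiWeight_le hq i j))
    _ = (1 / 2) * ((∑ i, R.diag i * (q i)⁻¹) * ∑ j, R.diag j) +
          (1 / 2) * ((∑ i, R.diag i) * ∑ j, R.diag j * (q j)⁻¹) := by
        rw [Finset.sum_mul_sum, Finset.sum_mul_sum, Finset.mul_sum, Finset.mul_sum,
          ← Finset.sum_add_distrib]
        refine Finset.sum_congr rfl fun i _ => ?_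
        rw [Finset.mul_sum, Finset.mul_sum, ← Finset.sum_add_distrib]
        refine Finset.sum_congr rfl fun j _ => ?_
        ring
    _ = R.invTrace q := by
        rw [R.sum_diag, State.invTrace]
        ring

theorem State.sum_sq_weight_le {d : ℕ} (R S : State d) {q : Fin d → ℝ} (hq : ∀ i, 0 < q i) :
    ∑ i, ∑ j, chiWeight q i j ^ 2 * (R.diag i * S.diag j) ≤ R.invTrace q * S.invTrace q := by
  rw [State.invTrace, State.invTrace, Finset.sum_mul_sum]
  refine Finset.sum_le_sum fun i _ => Finset.sum_le_sum fun j _ => ?_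
  calc chiWeight q i j ^ 2 * (R.diag i * S.diag j)
      ≤ (q i)⁻¹ * (q j)⁻¹ * (R.diag i * S.diag j) :=
        mul_le_mul_of_nonneg_right (chiWeight_sq_le hq i j)
          (mul_nonneg (R.diag_nonneg i) (S.diag_nonneg j))
    _ = _ := by ring

/-- The second moment of the effective one-body operator of a state in that state itself. -/
theorem State.trace_chiSchur_sq_le {d : ℕ} (R : State d) {q : Fin d → ℝ} (hq : ∀ i, 0 < q i) :
    (R.mat * (chiSchur q R.mat * chiSchur q R.mat)).trace.re ≤ R.invTrace q ^ 2 := by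
  have hprod : ∀ i j k, ‖R.mat i j‖ * ‖R.mat j k‖ * ‖R.mat k i‖ ≤
      R.diag i * R.diag j * R.diag k := by
    intro i j k
    have h1 := R.norm_sq_le i j
    have h2 := R.norm_sq_le j k
    have h3 := R.norm_sq_le k i
    have n1 := R.diag_nonneg i
    have n2 := R.diag_nonneg j
    have n3 := R.diag_nonneg k
    refine abs_le_of_sq_le_sq' ?_ (by positivity) |>.2
    calc (‖R.mat i j‖ * ‖R.mat j k‖ * ‖R.mat k i‖) ^ 2
        = ‖R.mat i j‖ ^ 2 * ‖R.mat j k‖ ^ 2 * ‖R.mat k i‖ ^ 2 := by ring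
      _ ≤ (R.diag i * R.diag j) * (R.diag j * R.diag k) * (R.diag k * R.diag i) := by gcongr
      _ = _ := by ring
  calc (R.mat * (chiSchur q R.mat * chiSchur q R.mat)).trace.re
      ≤ ‖(R.mat * (chiSchur q R.mat * chiSchur q R.mat)).trace‖ := Complex.re_le_norm _
    _ ≤ ∑ i, ∑ j, ∑ k, chiWeight q j k * chiWeight q k i *
          (‖R.mat i j‖ * ‖R.mat j k‖ * ‖R.mat k i‖) := by
        simp only [Matrix.trace, Matrix.diag_apply, Matrix.mul_apply, chiSchur, Matrix.of_apply,
          Finset.mul_sum]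
        refine (norm_sum_le _ _).trans (Finset.sum_le_sum fun i _ =>
          (norm_sum_le _ _).trans (Finset.sum_le_sum fun j _ =>
          (norm_sum_le _ _).trans (Finset.sum_le_sum fun k _ => le_of_eq ?_)))
        simp only [norm_mul, Complex.norm_real, Real.norm_eq_abs,
          abs_of_pos (chiWeight_pos hq _ _)]
        ring
    _ ≤ ∑ i, ∑ j, ∑ k, (chiWeight q j k ^ 2 + chiWeight q k i ^ 2) / 2 *
          (R.diag i * R.diag j * R.diag k) := by
        refine Finset.sum_le_sum fun i _ => Finset.sum_le_sum fun j _ =>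
          Finset.sum_le_sum fun k _ => ?_
        refine mul_le_mul ?_ (hprod i j k) (by positivity) (by positivity)
        nlinarith [sq_nonneg (chiWeight q j k - chiWeight q k i)]
    _ = ∑ j, ∑ k, chiWeight q j k ^ 2 * (R.diag j * R.diag k) := by
        have e1 : ∑ i, ∑ j, ∑ k, R.diag i * (chiWeight q j k ^ 2 * (R.diag j * R.diag k)) =
            ∑ j, ∑ k, chiWeight q j k ^ 2 * (R.diag j * R.diag k) := by
          simp only [← Finset.mul_sum, ← Finset.sum_mul, R.sum_diag, one_mul]
        have e2 : ∑ i, ∑ j, ∑ k, R.diag j * (chiWeight q k i ^ 2 * (R.diag k * R.diag i)) =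
            ∑ j, ∑ k, chiWeight q j k ^ 2 * (R.diag j * R.diag k) := by
          simp only [← Finset.mul_sum, ← Finset.sum_mul, R.sum_diag, one_mul]
          exact Finset.sum_comm
        have e3 : ∑ i, ∑ j, ∑ k, (chiWeight q j k ^ 2 + chiWeight q k i ^ 2) / 2 *
            (R.diag i * R.diag j * R.diag k) =
            1 / 2 * ∑ i, ∑ j, ∑ k, R.diag i * (chiWeight q j k ^ 2 * (R.diag j * R.diag k)) +
            1 / 2 * ∑ i, ∑ j, ∑ k, R.diag j * (chiWeight q k i ^ 2 * (R.diag k * R.diag i)) := by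
          simp only [Finset.mul_sum, ← Finset.sum_add_distrib]
          refine Finset.sum_congr rfl fun i _ => Finset.sum_congr rfl fun j _ =>
            Finset.sum_congr rfl fun k _ => ?_
          ring
        rw [e3, e1, e2]
        ring
    _ ≤ R.invTrace q ^ 2 := by
        rw [sq]
        exact R.sum_sq_weight_le R hq

theorem chiNorm_eq_sum {d : ℕ} {q : Fin d → ℝ} (hq : ∀ i, 0 < q i)
    (Δ : Matrix (Fin d) (Fin d) ℂ) :
    chiNorm q Δ = ∑ i, ∑ j, (q i + q j) / 2 * ‖chiSchur q Δ i j‖ ^ 2 := by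
  refine Finset.sum_congr rfl fun i _ => Finset.sum_congr rfl fun j _ => ?_
  have h1 := hq i
  have h2 := hq j
  simp only [chiSchur, Matrix.of_apply, norm_mul, Complex.norm_real, Real.norm_eq_abs, mul_pow,
    sq_abs, chiWeight]
  field_simp

/-- Cauchy--Schwarz for a cubic form: `tr (Q A³) ≤ tr (Q A²) ‖A‖`, for diagonal `Q` and the
Hilbert--Schmidt norm. -/
theorem sum_cubic_le {ι : Type*} [Fintype ι] (q : ι → ℝ) (hq : ∀ i, 0 ≤ q i) (a : ι → ι → ℝ)
    (ha : ∀ i j, a i j = a j i) :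
    ∑ i, ∑ j, ∑ k, q i * (a i j * a j k * a k i) ≤
      (∑ i, ∑ j, q i * a i j ^ 2) * √(∑ j, ∑ k, a j k ^ 2) := by
  rw [Finset.sum_mul]
  refine Finset.sum_le_sum fun i _ => ?_
  simp only [← Finset.mul_sum]
  rw [mul_assoc]
  refine mul_le_mul_of_nonneg_left ?_ (hq i)
  have h := Real.sum_mul_le_sqrt_mul_sqrt (Finset.univ : Finset (ι × ι))
    (fun p => a i p.1 * a p.2 i) (fun p => a p.1 p.2)
  simp only [Fintype.sum_prod_type] at h
  have h1 : ∑ j, ∑ k, (a i j * a k i) ^ 2 = (∑ j, a i j ^ 2) ^ 2 := by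
    rw [sq (∑ j, a i j ^ 2), Finset.sum_mul_sum]
    refine Finset.sum_congr rfl fun j _ => Finset.sum_congr rfl fun k _ => ?_
    rw [ha k i]
    ring
  rw [h1, Real.sqrt_sq (Finset.sum_nonneg fun j _ => sq_nonneg _)] at h
  refine le_trans (le_of_eq ?_) h
  refine Finset.sum_congr rfl fun j _ => Finset.sum_congr rfl fun k _ => ?_
  ring

theorem sum_norm_sq_chiSchur_le {d : ℕ} {q : Fin d → ℝ} {γ : ℝ} (hγ : 0 < γ) (hq : ∀ i, γ ≤ q i)
    (Δ : Matrix (Fin d) (Fin d) ℂ) :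
    ∑ i, ∑ j, ‖chiSchur q Δ i j‖ ^ 2 ≤ chiNorm q Δ / γ := by
  rw [chiNorm_eq_sum (fun i => hγ.trans_le (hq i)), le_div_iff₀ hγ, Finset.sum_mul]
  refine Finset.sum_le_sum fun i _ => ?_
  rw [Finset.sum_mul]
  refine Finset.sum_le_sum fun j _ => ?_
  rw [mul_comm]
  refine mul_le_mul_of_nonneg_right ?_ (sq_nonneg _)
  linarith [hq i, hq j]

/-- The expectation in `R = Q + Δ` of the square of the weighted deviation. Here
`Δ = (Q X + X Q) / 2` with `X = chiSchur q Δ`, so `tr (R X²) = tr (Q X²) + tr (Q X³)`. -/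
theorem State.trace_deviation_sq_le {d : ℕ} (R : State d) {q : Fin d → ℝ} {γ : ℝ} (hγ : 0 < γ)
    (hq : ∀ i, γ ≤ q i) {Δ : Matrix (Fin d) (Fin d) ℂ}
    (hΔ : R.mat = Matrix.diagonal (fun i => (q i : ℂ)) + Δ) (hH : Δ.IsHermitian) :
    (R.mat * (chiSchur q Δ * chiSchur q Δ)).trace.re ≤
      chiNorm q Δ + chiNorm q Δ * √(chiNorm q Δ / γ) := by
  have hq0 : ∀ i, 0 < q i := fun i => hγ.trans_le (hq i)
  set X := chiSchur q Δ with hX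
  have hXH : X.IsHermitian := chiSchur_isHermitian q hH
  have hsym : ∀ i j, ‖X i j‖ = ‖X j i‖ := fun i j => by rw [← hXH.apply i j, norm_star]
  have hD : chiNorm q Δ = ∑ i, ∑ j, q i * ‖X i j‖ ^ 2 := by
    have e : ∑ i, ∑ j, q j * ‖X i j‖ ^ 2 = ∑ i, ∑ j, q i * ‖X i j‖ ^ 2 := by
      rw [Finset.sum_comm]
      refine Finset.sum_congr rfl fun j _ => Finset.sum_congr rfl fun i _ => ?_
      rw [hsym]
    rw [chiNorm_eq_sum hq0, ← hX]
    simp only [add_div, add_mul, Finset.sum_add_distrib, div_mul_eq_mul_div, ← Finset.sum_div]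
    rw [e]
    ring
  have hΔX : ∀ i j, Δ i j = (((q i + q j) / 2 : ℝ) : ℂ) * X i j := by
    intro i j
    have h1 := hq0 i
    have h2 := hq0 j
    rw [hX, chiSchur, Matrix.of_apply, ← mul_assoc, ← Complex.ofReal_mul, chiWeight,
      mul_inv_cancel₀ (by positivity), Complex.ofReal_one, one_mul]
  have t1 : (Matrix.diagonal (fun i => (q i : ℂ)) * (X * X)).trace.re = chiNorm q Δ := by
    rw [hD]
    have hXX : ∀ i, (X * X) i i = ∑ j, X i j * X j i := fun i => Matrix.mul_apply
    simp only [Matrix.trace, Matrix.diag_apply, Matrix.diagonal_mul, hXX]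
    rw [Complex.re_sum]
    refine Finset.sum_congr rfl fun i _ => ?_
    rw [Finset.mul_sum, Complex.re_sum]
    refine Finset.sum_congr rfl fun j _ => ?_
    rw [← hXH.apply j i, Complex.star_def, Complex.mul_conj', Complex.re_ofReal_mul]
    norm_cast
  have t2 : (Δ * (X * X)).trace.re ≤ chiNorm q Δ * √(chiNorm q Δ / γ) := by
    calc (Δ * (X * X)).trace.re ≤ ‖(Δ * (X * X)).trace‖ := Complex.re_le_norm _
      _ ≤ ∑ i, ∑ j, ∑ k, (q i + q j) / 2 * (‖X i j‖ * ‖X j k‖ * ‖X k i‖) := by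
          simp only [Matrix.trace, Matrix.diag_apply, Matrix.mul_apply, Finset.mul_sum]
          refine (norm_sum_le _ _).trans (Finset.sum_le_sum fun i _ =>
            (norm_sum_le _ _).trans (Finset.sum_le_sum fun j _ =>
            (norm_sum_le _ _).trans (Finset.sum_le_sum fun k _ => le_of_eq ?_)))
          have h1 := hq0 i
          have h2 := hq0 j
          rw [norm_mul, norm_mul, hΔX, norm_mul, Complex.norm_real, Real.norm_eq_abs,
            abs_of_pos (by positivity)]
          ring
      _ = ∑ i, ∑ j, ∑ k, q i * (‖X i j‖ * ‖X j k‖ * ‖X k i‖) := by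
          have e : ∑ i, ∑ j, ∑ k, q j * (‖X i j‖ * ‖X j k‖ * ‖X k i‖) =
              ∑ i, ∑ j, ∑ k, q i * (‖X i j‖ * ‖X j k‖ * ‖X k i‖) := by
            rw [Finset.sum_comm]
            refine Finset.sum_congr rfl fun j _ => Finset.sum_congr rfl fun i _ =>
              Finset.sum_congr rfl fun k _ => ?_
            rw [hsym i j, hsym j k, hsym k i]
            ring
          simp only [add_div, add_mul, Finset.sum_add_distrib, div_mul_eq_mul_div,
            ← Finset.sum_div]
          rw [e]
          ring
      _ ≤ (∑ i, ∑ j, q i * ‖X i j‖ ^ 2) * √(∑ j, ∑ k, ‖X j k‖ ^ 2) :=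
          sum_cubic_le q (fun i => (hq0 i).le) _ hsym
      _ ≤ chiNorm q Δ * √(chiNorm q Δ / γ) := by
          rw [← hD]
          exact mul_le_mul_of_nonneg_left
            (Real.sqrt_le_sqrt (sum_norm_sq_chiSchur_le hγ hq Δ)) (chiNorm_nonneg hq0 Δ)
  rw [hΔ, Matrix.add_mul, Matrix.trace_add, Complex.add_re, t1]
  linarith

/-- Cauchy--Schwarz for `∑ i, Δ i i / q i`, the deviation of `tr (σ⁻¹ R)` from `tr 1 = d`. -/
theorem State.invTrace_le {d : ℕ} (R : State d) {q : Fin d → ℝ} {γ : ℝ} (hγ : 0 < γ)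
    (hq : ∀ i, γ ≤ q i) {Δ : Matrix (Fin d) (Fin d) ℂ}
    (hΔ : R.mat = Matrix.diagonal (fun i => (q i : ℂ)) + Δ) :
    R.invTrace q ≤ d + √(chiNorm q Δ) * √(d / γ) := by
  have hq0 : ∀ i, 0 < q i := fun i => hγ.trans_le (hq i)
  have hdiag : ∀ i, R.diag i * (q i)⁻¹ = 1 + (Δ i i).re * (q i)⁻¹ := by
    intro i
    have := (hq0 i).ne'
    rw [State.diag, hΔ, Matrix.add_apply, Matrix.diagonal_apply_eq, Complex.add_re,
      Complex.ofReal_re]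
    field_simp
  have h1 : ∑ i, (Δ i i).re * (q i)⁻¹ ≤ √(chiNorm q Δ) * √(d / γ) := by
    calc ∑ i, (Δ i i).re * (q i)⁻¹ = ∑ i, ((Δ i i).re * √((q i)⁻¹)) * √((q i)⁻¹) := by
          refine Finset.sum_congr rfl fun i _ => ?_
          rw [mul_assoc, Real.mul_self_sqrt (inv_nonneg.mpr (hq0 i).le)]
      _ ≤ √(∑ i, ((Δ i i).re * √((q i)⁻¹)) ^ 2) * √(∑ i, √((q i)⁻¹) ^ 2) :=
          Real.sum_mul_le_sqrt_mul_sqrt _ _ _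
      _ ≤ √(chiNorm q Δ) * √(d / γ) := by
          gcongr
          · refine Finset.sum_le_sum fun i _ => ?_
            refine le_trans ?_ (Finset.single_le_sum (f := fun j => chiWeight q i j * ‖Δ i j‖ ^ 2)
              (fun j _ => mul_nonneg (chiWeight_pos hq0 i j).le (sq_nonneg _)) (Finset.mem_univ i))
            rw [mul_pow, Real.sq_sqrt (inv_nonneg.mpr (hq0 i).le), mul_comm]
            have : chiWeight q i i = (q i)⁻¹ := by
              rw [chiWeight]
              congr 1
              ring
            simp only [this]
            refine mul_le_mul_of_nonneg_left ?_ (inv_nonneg.mpr (hq0 i).le)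
            rw [← sq_abs]
            gcongr
            exact Complex.abs_re_le_norm _
          · calc ∑ i, √((q i)⁻¹) ^ 2 ≤ ∑ _i : Fin d, γ⁻¹ := by
                  refine Finset.sum_le_sum fun i _ => ?_
                  rw [Real.sq_sqrt (inv_nonneg.mpr (hq0 i).le)]
                  exact inv_anti₀ hγ (hq i)
              _ = d / γ := by simp [div_eq_mul_inv]
  rw [State.invTrace, Finset.sum_congr rfl fun i _ => hdiag i, Finset.sum_add_distrib]
  simpa using h1

/-! ### Mean and variance of the summed collision observable -/

/-- The average state `(1/T) ∑ ρ_t`. -/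
def avgState {d T : ℕ} (hT : T ≠ 0) (ρ : Fin T → State d) : State d where
  mat := avgMat ρ
  psd := by
    refine Matrix.PosSemidef.smul (Matrix.posSemidef_sum _ fun t _ => (ρ t).psd) ?_
    simp
  trace_one := by
    simp [avgMat, Matrix.trace_sum, State.trace_one, hT]

theorem sum_inBasis {d T : ℕ} (hT : T ≠ 0) (ρ : Fin T → State d) (σ : State d) :
    ∑ t, ((ρ t).inBasis σ).mat = (T : ℂ) • ((avgState hT ρ).inBasis σ).mat := by
  simp [State.inBasis, avgState, avgMat, Finset.mul_sum, Finset.sum_mul, hT]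

theorem sum_trace_inBasis_mul {d T : ℕ} (hT : T ≠ 0) (ρ : Fin T → State d) (σ : State d)
    (A : Matrix (Fin d) (Fin d) ℂ) :
    ∑ t, (((ρ t).inBasis σ).mat * A).trace.re =
      T * (((avgState hT ρ).inBasis σ).mat * A).trace.re := by
  rw [← Complex.re_sum, ← Matrix.trace_sum, ← Finset.sum_mul, sum_inBasis hT, Matrix.smul_mul,
    Matrix.trace_smul, smul_eq_mul, ← Complex.ofReal_natCast, Complex.re_ofReal_mul]

theorem sum_invTrace_inBasis {d T : ℕ} (hT : T ≠ 0) (ρ : Fin T → State d) (σ : State d)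
    (q : Fin d → ℝ) :
    ∑ t, ((ρ t).inBasis σ).invTrace q = T * ((avgState hT ρ).inBasis σ).invTrace q := by
  simp only [State.invTrace]
  rw [Finset.sum_comm, Finset.mul_sum]
  refine Finset.sum_congr rfl fun i _ => ?_
  rw [← Finset.sum_mul, ← mul_assoc]
  congr 1
  have := congrArg Complex.re (congrFun (congrFun (sum_inBasis hT ρ σ) i) i)
  rw [Matrix.sum_apply, Complex.re_sum, Matrix.smul_apply, smul_eq_mul, ← Complex.ofReal_natCast,
    Complex.re_ofReal_mul] at this
  exact this

theorem trace_mul_im_eq_zero {d : ℕ} {A B : Matrix (Fin d) (Fin d) ℂ} (hA : A.IsHermitian)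
    (hB : B.IsHermitian) : (A * B).trace.im = 0 := by
  have h : star (A * B).trace = (A * B).trace := by
    rw [← Matrix.trace_conjTranspose, Matrix.conjTranspose_mul, hA.eq, hB.eq, Matrix.trace_mul_comm]
  exact Complex.conj_eq_iff_im.mp h

theorem trace_pairOp_im {d T : ℕ} (ρ : Fin T → State d) (σ : State d) (s t : Fin T) :
    (prodState ρ * pairOp σ s t).trace.im = 0 := by
  by_cases h : s = t
  · simp [h, pairOp_self]
  · rw [trace_pairOp ρ σ h]
    exact trace_mul_im_eq_zero (State.herm _) (chiSchur_isHermitian _ (State.herm _))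

/-- The sum over `s ≠ t` of the collision observable on the components `s` and `t`. -/
def sumOp {d : ℕ} (σ : State d) (T : ℕ) : Op d T := ∑ s, ∑ t, pairOp σ s t

/-- The full double sum over `s` and `t` is bilinear in the average; subtract the diagonal. -/
theorem trace_sumOp {d T : ℕ} (hT : T ≠ 0) (ρ : Fin T → State d) (σ : State d) :
    (prodState ρ * sumOp σ T).trace.re =
      T ^ 2 * chiNorm σ.eig ((avgState hT ρ).inBasis σ).mat -
        ∑ s, chiNorm σ.eig ((ρ s).inBasis σ).mat := by
  have key : ∀ s t, (prodState ρ * pairOp σ s t).trace =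
      (((ρ s).inBasis σ).mat * chiSchur σ.eig ((ρ t).inBasis σ).mat).trace -
        if s = t then (chiNorm σ.eig ((ρ s).inBasis σ).mat : ℂ) else 0 := by
    intro s t
    by_cases h : s = t
    · subst h
      simp [pairOp_self, trace_mul_chiSchur _ (State.herm _)]
    · simp [trace_pairOp ρ σ h, h]
  have h : (prodState ρ * sumOp σ T).trace =
      ((T ^ 2 * chiNorm σ.eig ((avgState hT ρ).inBasis σ).mat -
        ∑ s, chiNorm σ.eig ((ρ s).inBasis σ).mat : ℝ) : ℂ) := by
    simp only [sumOp, Finset.mul_sum, Matrix.trace_sum, key, Finset.sum_sub_distrib,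
      Finset.sum_ite_eq, Finset.mem_univ, if_true]
    simp only [← Matrix.trace_sum, ← Finset.mul_sum, ← chiSchur_sum, sum_inBasis hT,
      chiSchur_smul, Matrix.mul_smul]
    simp only [← Finset.sum_mul, ← Finset.smul_sum, sum_inBasis hT, Matrix.smul_mul,
      Matrix.trace_smul, trace_mul_chiSchur _ (State.herm _)]
    push_cast
    simp only [smul_eq_mul]
    ring
  rw [h, Complex.ofReal_re]


theorem sum_sum_mul_sum_sum {ι α : Type*} [Fintype ι] [NonUnitalNonAssocSemiring α]
    (A B : ι → ι → α) :
    (∑ s, ∑ t, A s t) * ∑ a, ∑ b, B a b = ∑ s, ∑ t, ∑ a, ∑ b, A s t * B a b := by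
  rw [Finset.sum_mul]
  refine Finset.sum_congr rfl fun s _ => ?_
  rw [Finset.sum_mul]
  refine Finset.sum_congr rfl fun t _ => ?_
  rw [Finset.mul_sum]
  refine Finset.sum_congr rfl fun a _ => ?_
  rw [Finset.mul_sum]

theorem re_trace_mul_sum {ι n : Type*} [Fintype ι] [Fintype n] (A : Matrix n n ℂ)
    (B : ι → Matrix n n ℂ) : (A * ∑ s, B s).trace.re = ∑ s, (A * B s).trace.re := by
  rw [Finset.mul_sum, Matrix.trace_sum, Complex.re_sum]

/-- The variance of the summed collision observable. Pairs without a common component are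
uncorrelated. Pairs that share exactly one component `s` give, after the square completes, the
variance in `ρ_s` of the effective one-body operator `∑ t ≠ s, chiSchur q ρ_t`, which is governed by
the deviation of the average from `σ`; coinciding pairs give the second moment of the collision
observable. -/
theorem variance_sumOp_le {d T : ℕ} (hT : T ≠ 0) (ρ : Fin T → State d) (σ : State d)
    (hq : ∀ i, 0 < σ.eig i) {Δ : Matrix (Fin d) (Fin d) ℂ}
    (hΔ : ((avgState hT ρ).inBasis σ).mat = Matrix.diagonal (fun i => (σ.eig i : ℂ)) + Δ)
    (hH : Δ.IsHermitian) :
    (prodState ρ * (sumOp σ T * sumOp σ T)).trace.re - (prodState ρ * sumOp σ T).trace.re ^ 2 ≤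
      8 * T ^ 3 * (((avgState hT ρ).inBasis σ).mat *
        (chiSchur σ.eig Δ * chiSchur σ.eig Δ)).trace.re +
      10 * T ^ 2 * ((avgState hT ρ).inBasis σ).invTrace σ.eig ^ 2 := by
  set q := σ.eig with hqdef
  set R : Fin T → State d := fun t => (ρ t).inBasis σ with hR
  set Rb := (avgState hT ρ).inBasis σ with hRb
  set L : Fin T → Matrix (Fin d) (Fin d) ℂ := fun t => chiSchur q (R t).mat with hL
  have hLH : ∀ t, (L t).IsHermitian := fun t => chiSchur_isHermitian _ (State.herm _)
  set G : Fin T → Fin T → Fin T → Fin T → ℝ := fun s t a b =>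
    (prodState ρ * (pairOp σ s t * pairOp σ a b)).trace.re -
      (prodState ρ * pairOp σ s t).trace.re * (prodState ρ * pairOp σ a b).trace.re with hG
  have hV : (prodState ρ * (sumOp σ T * sumOp σ T)).trace.re -
      (prodState ρ * sumOp σ T).trace.re ^ 2 = ∑ s, ∑ t, ∑ a, ∑ b, G s t a b := by
    have e1 : (prodState ρ * (sumOp σ T * sumOp σ T)).trace.re =
        ∑ s, ∑ t, ∑ a, ∑ b, (prodState ρ * (pairOp σ s t * pairOp σ a b)).trace.re := by
      rw [sumOp, sum_sum_mul_sum_sum]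
      simp only [re_trace_mul_sum]
    have e2 : (prodState ρ * sumOp σ T).trace.re =
        ∑ s, ∑ t, (prodState ρ * pairOp σ s t).trace.re := by
      simp only [sumOp, re_trace_mul_sum]
    rw [e1, e2, sq, sum_sum_mul_sum_sum]
    simp only [hG, Finset.sum_sub_distrib]
  have hsum := sum_overlapping_pairs G
    (fun s t a b => by simp only [hG, pairOp_comm σ s t])
    (fun s t a b => by simp only [hG, pairOp_comm σ a b])
    (fun s a b => by simp [hG, pairOp_self])
    (fun s t a => by simp [hG, pairOp_self])
    (fun s t a b hst hsa hsb hta htb hab => by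
      simp only [hG]
      rw [trace_pairOp_mul_pairOp_disjoint ρ σ hst hsa hsb hta htb hab, Complex.mul_re,
        trace_pairOp_im]
      ring)
  -- second moments of the collision observable on one pair
  set v : Fin T → Fin T → ℝ := fun s t =>
    ∑ i, ∑ j, chiWeight q i j ^ 2 * ((R s).diag i * (R t).diag j) with hv
  have hsq : ∀ s t, s ≠ t → (prodState ρ * (pairOp σ s t * pairOp σ s t)).trace.re = v s t := by
    intro s t hst
    rw [trace_pairOp_sq ρ σ hst]
    simp only [hv, ← State.ofReal_diag]
    norm_cast
  have hc : ∀ s t, s ≠ t → (prodState ρ * pairOp σ s t).trace.re =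
      ((R s).mat * L t).trace.re := fun s t hst => by rw [trace_pairOp ρ σ hst]
  -- `Z s t` acts on `s` for the pair `(s, t)`; `e s t` is what the coinciding pairs `t = u` add to
  -- the covariance of the effective one-body operators
  set Z : Fin T → Fin T → Matrix (Fin d) (Fin d) ℂ := fun s t => if s = t then 0 else L t with hZ
  set e : Fin T → Fin T → ℝ := fun s t =>
    if s = t then 0 else v s t - ((R s).mat * (L t * L t)).trace.re with he
  have hGs : ∀ s t u, G s t s u = (((R s).mat * (Z s t * Z s u)).trace.re -
      ((R s).mat * Z s t).trace.re * ((R s).mat * Z s u).trace.re) +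
        if t = u then e s t else 0 := by
    intro s t u
    by_cases hst : s = t
    · simp [hG, hZ, he, hst, pairOp_self]
    by_cases hsu : s = u
    · subst hsu
      simp [hG, hZ, Ne.symm hst, pairOp_self]
    by_cases htu : t = u
    · subst htu
      simp only [hG, hZ, he, if_neg hst, if_true, hsq s t hst, hc s t hst]
      ring
    · simp only [hG, hZ, if_neg hst, if_neg hsu, if_neg htu, hc s t hst, hc s u hsu,
        trace_pairOp_mul_pairOp_shared ρ σ hst hsu htu, add_zero]
      rfl
  have hrow : ∀ s, ∑ t, ∑ u, G s t s u =
      (((R s).mat * ((∑ t, Z s t) * ∑ t, Z s t)).trace.re -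
        ((R s).mat * ∑ t, Z s t).trace.re ^ 2) + ∑ t, e s t := by
    intro s
    simp only [hGs, Finset.sum_add_distrib, Finset.sum_sub_distrib, Finset.sum_ite_eq,
      Finset.mem_univ, if_true]
    rw [sq]
    simp only [re_trace_mul_sum]
    rw [Finset.sum_mul_sum, Finset.sum_mul_sum]
    simp only [re_trace_mul_sum]
  have hvar : ∀ s, (((R s).mat * ((∑ t, Z s t) * ∑ t, Z s t)).trace.re -
        ((R s).mat * ∑ t, Z s t).trace.re ^ 2) ≤
      2 * T ^ 2 * ((R s).mat * (chiSchur q Δ * chiSchur q Δ)).trace.re +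
        2 * (R s).invTrace q ^ 2 := by
    intro s
    -- `chiSchur q` maps the diagonal matrix of `q` to `1`, hence the scalar summand
    have hY : ∑ t, Z s t = ((T : ℝ) : ℂ) • 1 + ((T : ℂ) • chiSchur q Δ - L s) := by
      have h1 : ∀ t, Z s t = L t - if s = t then L t else 0 := by
        intro t
        by_cases h : s = t <;> simp [hZ, h]
      simp only [h1, Finset.sum_sub_distrib, Finset.sum_ite_eq, Finset.mem_univ, if_true]
      rw [hL, ← chiSchur_sum, hR, sum_inBasis hT, chiSchur_smul, ← hRb, hΔ, chiSchur_add,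
        chiSchur_diagonal hq, smul_add, add_sub_assoc]
      simp
    have hTH : ((T : ℂ) • chiSchur q Δ).IsHermitian := by
      have := chiSchur_isHermitian q hH
      simp [Matrix.IsHermitian, Matrix.conjTranspose_smul, this.eq]
    have := (R s).variance_le T hTH (hLH s) hY
    have h2 := (R s).trace_chiSchur_sq_le hq
    have h3 : ((R s).mat * (((T : ℂ) • chiSchur q Δ) * ((T : ℂ) • chiSchur q Δ))).trace.re =
        T ^ 2 * ((R s).mat * (chiSchur q Δ * chiSchur q Δ)).trace.re := by
      simp only [Matrix.smul_mul, Matrix.mul_smul, Matrix.trace_smul, smul_eq_mul,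
        ← Complex.ofReal_natCast, Complex.re_ofReal_mul]
      ring
    rw [h3] at this
    linarith
  have hpair : ∀ s t, 4 * e s t - 2 * G s t s t ≤ 2 * ((R s).invTrace q * (R t).invTrace q) := by
    intro s t
    have hf := mul_nonneg ((R s).invTrace_nonneg hq) ((R t).invTrace_nonneg hq)
    by_cases hst : s = t
    · simpa [hG, he, hst, pairOp_self] using hf
    · have h1 := (R s).sum_sq_weight_le (R t) hq
      have h2 := (R s).sq_trace_le (hLH t)
      have h3 := (R s).trace_sq_nonneg (hLH t)
      simp only [hG, he, if_neg hst, hsq s t hst, hc s t hst]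
      simp only [hv]
      nlinarith
  have hfs : ∀ s, 0 ≤ (R s).invTrace q := fun s => (R s).invTrace_nonneg hq
  have hF : ∑ s, (R s).invTrace q = T * Rb.invTrace q := sum_invTrace_inBasis hT ρ σ q
  have hFsq : ∑ s, (R s).invTrace q ^ 2 ≤ (T * Rb.invTrace q) ^ 2 := by
    rw [← hF]
    exact Finset.sum_sq_le_sq_sum_of_nonneg fun s _ => hfs s
  rw [hV, hsum]
  calc 4 * ∑ s, ∑ t, ∑ u, G s t s u - 2 * ∑ s, ∑ t, G s t s t
      = 4 * ∑ s, (((R s).mat * ((∑ t, Z s t) * ∑ t, Z s t)).trace.re -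
        ((R s).mat * ∑ t, Z s t).trace.re ^ 2) + ∑ s, ∑ t, (4 * e s t - 2 * G s t s t) := by
        simp only [hrow, Finset.sum_add_distrib, Finset.sum_sub_distrib, ← Finset.mul_sum]
        ring
    _ ≤ 4 * ∑ s, (2 * T ^ 2 * ((R s).mat * (chiSchur q Δ * chiSchur q Δ)).trace.re +
        2 * (R s).invTrace q ^ 2) + ∑ s, ∑ t, 2 * ((R s).invTrace q * (R t).invTrace q) := by
        refine add_le_add (mul_le_mul_of_nonneg_left (Finset.sum_le_sum fun s _ => hvar s)
          (by norm_num)) (Finset.sum_le_sum fun s _ => Finset.sum_le_sum fun t _ => hpair s t)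
    _ = 8 * T ^ 3 * (Rb.mat * (chiSchur q Δ * chiSchur q Δ)).trace.re +
        8 * ∑ s, (R s).invTrace q ^ 2 + 2 * (T * Rb.invTrace q) ^ 2 := by
        rw [Finset.sum_add_distrib, ← Finset.mul_sum, ← Finset.mul_sum,
          sum_trace_inBasis_mul hT ρ σ]
        simp only [← Finset.mul_sum, ← Finset.sum_mul, hF]
        ring
    _ ≤ _ := by
        rw [mul_pow] at hFsq ⊢
        linarith

/-! ### Chebyshev's inequality for the measurement of an observable -/

theorem re_trace_mul_conj_diagonal {n : Type*} [Fintype n] [DecidableEq n] (P U : Matrix n n ℂ)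
    (f : n → ℝ) :
    (P * (U * Matrix.diagonal (fun k => (f k : ℂ)) * Uᴴ)).trace.re =
      ∑ k, ((Uᴴ * P * U) k k).re * f k := by
  have h : (P * (U * Matrix.diagonal (fun k => (f k : ℂ)) * Uᴴ)).trace =
      ((Uᴴ * P * U) * Matrix.diagonal (fun k => (f k : ℂ))).trace := by
    rw [← Matrix.mul_assoc, Matrix.trace_mul_comm]
    simp only [Matrix.mul_assoc]
  rw [h]
  simp only [Matrix.trace, Matrix.diag_apply, Matrix.mul_diagonal, Complex.re_sum,
    Complex.re_mul_ofReal]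

theorem spectralProj_eq {d T : ℕ} {A : Op d T} (hA : A.IsHermitian) (S : Set ℝ) :
    spectralProj hA S = (hA.eigenvectorUnitary : Op d T) *
      Matrix.diagonal (fun k => ((S.indicator (fun _ => (1 : ℝ)) (hA.eigenvalues k) : ℝ) : ℂ)) *
      (hA.eigenvectorUnitary : Op d T)ᴴ := by
  unfold spectralProj
  congr 3
  ext k
  by_cases h : hA.eigenvalues k ∈ S <;> simp [h]

/-- Chebyshev's inequality for the outcome distribution of an observable. -/
theorem measureProb_ge {d T : ℕ} {A : Op d T} (hA : A.IsHermitian) {P : Op d T}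
    (hP : P.PosSemidef) (htr : P.trace = 1) {S : Set ℝ} {g : ℝ} (hg : 0 < g)
    (hS : ∀ x, x ∉ S → g ≤ |x - (P * A).trace.re|)
    (hV : (P * (A * A)).trace.re - (P * A).trace.re ^ 2 ≤ 0.01 * g ^ 2) :
    0.99 ≤ measureProb hA P S := by
  set U := (hA.eigenvectorUnitary : Op d T) with hU
  have hU1 : U * Uᴴ = 1 := Unitary.mul_star_self_of_mem hA.eigenvectorUnitary.2
  have hU2 : Uᴴ * U = 1 := Unitary.star_mul_self_of_mem hA.eigenvectorUnitary.2
  set l := hA.eigenvalues with hl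
  have hAeq : A = U * Matrix.diagonal (fun k => (l k : ℂ)) * Uᴴ := by
    have := hA.spectral_theorem
    rw [Unitary.conjStarAlgAut_apply] at this
    exact this
  have hAAeq : A * A = U * Matrix.diagonal (fun k => ((l k ^ 2 : ℝ) : ℂ)) * Uᴴ := by
    conv_lhs => rw [hAeq]
    calc _ = U * (Matrix.diagonal (fun k => (l k : ℂ)) * (Uᴴ * U) *
          Matrix.diagonal (fun k => (l k : ℂ))) * Uᴴ := by simp only [Matrix.mul_assoc]
      _ = _ := by
        rw [hU2, Matrix.mul_one, Matrix.diagonal_mul_diagonal]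
        simp only [sq, Complex.ofReal_mul]
  set p : (Fin T → Fin d) → ℝ := fun k => ((Uᴴ * P * U) k k).re with hp
  have hp0 : ∀ k, 0 ≤ p k := fun k =>
    (Complex.le_def.mp ((hP.conjTranspose_mul_mul_same U).diag_nonneg (i := k))).1
  have hp1 : ∑ k, p k = 1 := by
    have h := re_trace_mul_conj_diagonal P U (fun _ => 1)
    simp only [Complex.ofReal_one, Matrix.diagonal_one, hU1, htr, mul_one] at h
    exact h.symm
  have hm : (P * A).trace.re = ∑ k, p k * l k := by
    conv_lhs => rw [hAeq]
    exact re_trace_mul_conj_diagonal P U l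
  have hm2 : (P * (A * A)).trace.re = ∑ k, p k * l k ^ 2 := by
    rw [hAAeq]
    exact re_trace_mul_conj_diagonal P U _
  have hprob : measureProb hA P S = ∑ k, p k * S.indicator (fun _ => (1 : ℝ)) (l k) := by
    rw [measureProb, spectralProj_eq]
    exact re_trace_mul_conj_diagonal P U _
  set m := (P * A).trace.re
  have hvar : ∑ k, p k * (l k - m) ^ 2 = (P * (A * A)).trace.re - m ^ 2 := by
    have : ∀ k, p k * (l k - m) ^ 2 = p k * l k ^ 2 - 2 * m * (p k * l k) + m ^ 2 * p k :=
      fun k => by ring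
    simp only [this, Finset.sum_add_distrib, Finset.sum_sub_distrib, ← Finset.mul_sum, ← hm, ← hm2,
      hp1]
    ring
  have hmarkov : ∑ k, p k * (g ^ 2 * (1 - S.indicator (fun _ => (1 : ℝ)) (l k))) ≤
      ∑ k, p k * (l k - m) ^ 2 := by
    refine Finset.sum_le_sum fun k _ => mul_le_mul_of_nonneg_left ?_ (hp0 k)
    by_cases h : l k ∈ S
    · simpa [h] using sq_nonneg _
    · rw [Set.indicator_of_notMem h, sub_zero, mul_one, ← sq_abs (l k - m)]
      exact pow_le_pow_left₀ hg.le (hS _ h) 2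
  have hlhs : ∑ k, p k * (g ^ 2 * (1 - S.indicator (fun _ => (1 : ℝ)) (l k))) =
      g ^ 2 * (1 - measureProb hA P S) := by
    rw [hprob, mul_sub, ← hp1, Finset.mul_sum, Finset.mul_sum, ← Finset.sum_sub_distrib, hp1]
    exact Finset.sum_congr rfl fun k _ => by ring
  rw [hlhs, hvar] at hmarkov
  have : g ^ 2 * (1 - measureProb hA P S) ≤ g ^ 2 * 0.01 := by linarith
  have := le_of_mul_le_mul_left this (by positivity)
  linarith

/-! ### The measurement of `M` -/

theorem sumOp_eq_two_smul {d : ℕ} (σ : State d) (T : ℕ) :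
    sumOp σ T = (2 : ℝ) • ∑ s : Fin T, ∑ t ∈ Finset.Ioi s, twoBody (collision σ) s t := by
  have h1 : ∀ s t : Fin T, s < t → pairOp σ s t = twoBody (collision σ) s t := fun s t h =>
    if_neg h.ne
  have h2 : sumOp σ T = ∑ s : Fin T, ∑ t ∈ {s}ᶜ, pairOp σ t s := by
    refine Finset.sum_congr rfl fun s _ => ?_
    rw [Finset.sum_congr rfl fun t _ => pairOp_comm σ s t,
      ← Finset.add_sum_erase _ _ (Finset.mem_univ s), pairOp_self, zero_add, Finset.compl_singleton]
  rw [h2, ← Finset.sum_sum_Ioi_add_eq_sum_sum_off_diag, Finset.smul_sum]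
  refine Finset.sum_congr rfl fun s _ => ?_
  rw [Finset.smul_sum]
  refine Finset.sum_congr rfl fun t ht => ?_
  rw [pairOp_comm σ t s, h1 s t (Finset.mem_Ioi.mp ht), two_smul]

/-- For `T = 1` both sides vanish, so the junk value of `(T.choose 2)⁻¹` does no harm. -/
theorem observableM_eq {d T : ℕ} (hT : T ≠ 0) (σ : State d) :
    observableM σ T = ((T : ℝ) ^ 2)⁻¹ • (sumOp σ T - ((T : ℝ) * (T - 1)) • (1 : Op d T)) := by
  by_cases h1 : T = 1
  · subst h1
    simp [observableM, sumOp, pairOp_self]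
  have hT0 : (T : ℝ) ≠ 0 := by exact_mod_cast hT
  have hT1 : (T : ℝ) - 1 ≠ 0 := sub_ne_zero.mpr (by exact_mod_cast h1)
  rw [observableM, sumOp_eq_two_smul, Nat.cast_choose_two, smul_sub, smul_sub, smul_smul,
    smul_smul, smul_smul]
  congr 2 <;> field_simp

theorem State.eig_sum {d : ℕ} (σ : State d) : ∑ i, σ.eig i = 1 := by
  have h := σ.herm.trace_eq_sum_eigenvalues
  rw [σ.trace_one] at h
  have := congrArg Complex.re h
  simpa [State.eig] using this.symm

theorem State.inBasis_self {d : ℕ} (σ : State d) :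
    (σ.inBasis σ).mat = Matrix.diagonal fun i => (σ.eig i : ℂ) := by
  have hs : σ.mat = σ.basis * Matrix.diagonal (fun i => (σ.eig i : ℂ)) * σ.basisᴴ := by
    have := σ.herm.spectral_theorem
    rw [Unitary.conjStarAlgAut_apply] at this
    exact this
  change σ.basisᴴ * σ.mat * σ.basis = _
  conv_lhs => rw [hs]
  calc _ = (σ.basisᴴ * σ.basis) * Matrix.diagonal (fun i => (σ.eig i : ℂ)) *
        (σ.basisᴴ * σ.basis) := by simp only [Matrix.mul_assoc]
    _ = _ := by rw [σ.conjTranspose_mul_basis, Matrix.one_mul, Matrix.mul_one]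

/-- `⟨R, R⟩ = 1 + ⟨R - σ, R - σ⟩` for the weighted inner product, since `⟨σ, R⟩ = tr R = 1`. -/
theorem State.chiNorm_eq {d : ℕ} (R : State d) {q : Fin d → ℝ} (hq : ∀ i, 0 < q i)
    (hq1 : ∑ i, q i = 1) {Δ : Matrix (Fin d) (Fin d) ℂ}
    (hΔ : R.mat = Matrix.diagonal (fun i => (q i : ℂ)) + Δ) :
    chiNorm q R.mat = 1 + chiNorm q Δ := by
  have hH : Δ.IsHermitian := by
    have : Δ = R.mat - Matrix.diagonal (fun i => (q i : ℂ)) := by rw [hΔ]; simp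
    rw [this]
    refine R.herm.sub (Matrix.isHermitian_diagonal_of_self_adjoint _ ?_)
    ext i
    simp
  have htr : Δ.trace = 0 := by
    have := R.trace_one
    rw [hΔ, Matrix.trace_add, Matrix.trace_diagonal, ← Complex.ofReal_sum, hq1] at this
    simpa using this
  have hL : chiSchur q R.mat = 1 + chiSchur q Δ := by rw [hΔ, chiSchur_add, chiSchur_diagonal hq]
  have hQ : (Matrix.diagonal (fun i => (q i : ℂ)) * chiSchur q Δ).trace = Δ.trace := by
    simp only [Matrix.trace, Matrix.diag_apply, Matrix.diagonal_mul, chiSchur, Matrix.of_apply]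
    refine Finset.sum_congr rfl fun i _ => ?_
    have := (hq i).ne'
    rw [← mul_assoc, ← Complex.ofReal_mul, chiWeight, add_self_div_two, mul_inv_cancel₀ this]
    simp
  have h := trace_mul_chiSchur q R.herm
  rw [hL, Matrix.mul_add, Matrix.mul_one, Matrix.trace_add, R.trace_one] at h
  conv_lhs at h => rw [hΔ, Matrix.add_mul, Matrix.trace_add, hQ, htr, trace_mul_chiSchur q hH]
  exact_mod_cast (by simpa using h.symm : (chiNorm q R.mat : ℂ) = 1 + chiNorm q Δ)

/-- The deviation of a matrix from `σ`, written in the eigenbasis of `σ`. -/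
def State.deviation {d : ℕ} (σ : State d) (ρ : Matrix (Fin d) (Fin d) ℂ) :
    Matrix (Fin d) (Fin d) ℂ :=
  σ.basisᴴ * (ρ - σ.mat) * σ.basis

theorem State.inBasis_eq_add {d : ℕ} (ρ σ : State d) :
    (ρ.inBasis σ).mat = Matrix.diagonal (fun i => (σ.eig i : ℂ)) + σ.deviation ρ.mat := by
  rw [← State.inBasis_self]
  simp only [State.inBasis, State.deviation, Matrix.mul_sub, Matrix.sub_mul]
  abel

theorem State.deviation_isHermitian {d : ℕ} (ρ σ : State d) :
    (σ.deviation ρ.mat).IsHermitian :=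
  Matrix.isHermitian_conjTranspose_mul_mul _ (ρ.herm.sub σ.herm)

theorem buresChiSq_eq_chiNorm {d : ℕ} (ρ : Matrix (Fin d) (Fin d) ℂ) (σ : State d)
    (hq : ∀ i, 0 < σ.eig i) :
    buresChiSq ρ σ = ENNReal.ofReal (chiNorm σ.eig (σ.deviation ρ)) := by
  rw [buresChiSq, chiSqDiag, chiNorm, ENNReal.ofReal_sum_of_nonneg fun i _ =>
    Finset.sum_nonneg fun j _ => mul_nonneg (chiWeight_pos hq i j).le (sq_nonneg _)]
  refine Finset.sum_congr rfl fun i _ => ?_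
  rw [ENNReal.ofReal_sum_of_nonneg fun j _ =>
    mul_nonneg (chiWeight_pos hq i j).le (sq_nonneg _)]
  refine Finset.sum_congr rfl fun j _ => ?_
  rw [← ENNReal.ofReal_div_of_pos (add_pos (hq i) (hq j)), State.deviation, chiWeight]
  congr 1
  have := add_pos (hq i) (hq j)
  field_simp

/-- The mean of `M` is `D - b`, where `D` is the divergence of the average and the bias `b` is the
contribution of the missing diagonal pairs `s = t`. -/
theorem trace_observableM {d T : ℕ} (hT : T ≠ 0) (ρ : Fin T → State d) (σ : State d)
    (hq : ∀ i, 0 < σ.eig i) :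
    (prodState ρ * observableM σ T).trace.re =
      chiNorm σ.eig (σ.deviation (avgMat ρ)) -
        ((T : ℝ) ^ 2)⁻¹ * ∑ s, (chiNorm σ.eig ((ρ s).inBasis σ).mat - 1) := by
  have hT0 : (T : ℝ) ≠ 0 := by exact_mod_cast hT
  have h := State.chiNorm_eq _ hq σ.eig_sum ((avgState hT ρ).inBasis_eq_add σ)
  rw [observableM_eq hT, Matrix.mul_smul, Matrix.trace_smul, Matrix.mul_sub, Matrix.mul_smul,
    Matrix.trace_sub, Matrix.trace_smul, Matrix.mul_one, trace_prodState, Complex.smul_re,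
    Complex.sub_re, Complex.smul_re, Complex.one_re, trace_sumOp hT, h, avgState]
  simp only [smul_eq_mul, Finset.sum_sub_distrib, Finset.sum_const, Finset.card_univ,
    Fintype.card_fin, nsmul_eq_mul]
  field_simp
  ring

theorem variance_observableM {d T : ℕ} (hT : T ≠ 0) (ρ : Fin T → State d) (σ : State d) :
    (prodState ρ * (observableM σ T * observableM σ T)).trace.re -
      (prodState ρ * observableM σ T).trace.re ^ 2 =
    ((T : ℝ) ^ 4)⁻¹ * ((prodState ρ * (sumOp σ T * sumOp σ T)).trace.re -
      (prodState ρ * sumOp σ T).trace.re ^ 2) := by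
  have hT0 : (T : ℝ) ≠ 0 := by exact_mod_cast hT
  simp only [observableM_eq hT, Matrix.smul_mul, Matrix.mul_smul, Matrix.trace_smul,
    Matrix.mul_sub, Matrix.sub_mul, Matrix.mul_one, Matrix.one_mul, Matrix.trace_sub,
    Complex.smul_re, Complex.sub_re, trace_prodState, Complex.one_re, smul_eq_mul]
  field_simp
  ring

/-- Mean and variance of `M` under the sample size condition, with `N` an upper bound for both the
divergence of the average and the threshold `θ`. -/
theorem observableM_moments {d T : ℕ} (hT : T ≠ 0) (ρ : Fin T → State d) (σ : State d)
    {γ θ K N : ℝ} (hγ : 0 < γ) (hq : ∀ i, γ ≤ σ.eig i) (hθ : 0 < θ) (hK : 40 ≤ K) (hd : 1 ≤ d)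
    (h1 : K * d ≤ T * θ) (h2 : K ^ 2 * d ≤ T ^ 2 * (θ * γ)) (hθN : θ ≤ N)
    (hDN : chiNorm σ.eig (σ.deviation (avgMat ρ)) ≤ N) :
    chiNorm σ.eig (σ.deviation (avgMat ρ)) - 2 * N / K ≤
        (prodState ρ * observableM σ T).trace.re ∧
      (prodState ρ * observableM σ T).trace.re ≤ chiNorm σ.eig (σ.deviation (avgMat ρ)) ∧
      (prodState ρ * (observableM σ T * observableM σ T)).trace.re -
        (prodState ρ * observableM σ T).trace.re ^ 2 ≤ 17 * N ^ 2 / K := by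
  have hq0 : ∀ i, 0 < σ.eig i := fun i => hγ.trans_le (hq i)
  have hT0 : (0 : ℝ) < T := by exact_mod_cast Nat.pos_of_ne_zero hT
  have hd0 : (1 : ℝ) ≤ d := by exact_mod_cast hd
  have hK0 : 0 < K := by linarith
  have hΔ := (avgState hT ρ).inBasis_eq_add σ
  have hH := (avgState hT ρ).deviation_isHermitian σ
  set Rb := (avgState hT ρ).inBasis σ with hRb
  change Rb.mat = _ + σ.deviation (avgMat ρ) at hΔ
  change (σ.deviation (avgMat ρ)).IsHermitian at hH
  set D := chiNorm σ.eig (σ.deviation (avgMat ρ)) with hD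
  have hD0 : 0 ≤ D := chiNorm_nonneg hq0 _
  have hN0 : 0 < N := hθ.trans_le hθN
  have hF := Rb.invTrace_le hγ hq hΔ
  have hX := Rb.trace_deviation_sq_le hγ hq hΔ hH
  rw [← hD] at hF hX
  set F := Rb.invTrace σ.eig with hFdef
  have hF0 : 0 ≤ F := Rb.invTrace_nonneg hq0
  -- the three error terms, relative to the sample size
  have e1 : (d : ℝ) ≤ T * (N / K) := by
    rw [mul_div_assoc', le_div_iff₀ hK0]
    nlinarith
  have e2 : √D * √(d / γ) ≤ T * (N / K) := by
    rw [← Real.sqrt_mul hD0]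
    refine Real.sqrt_le_iff.mpr ⟨by positivity, ?_⟩
    rw [mul_div_assoc', div_le_iff₀ hγ, div_eq_mul_inv, mul_pow, mul_pow, inv_pow,
      ← div_eq_mul_inv, mul_div_assoc', div_mul_eq_mul_div, le_div_iff₀ (by positivity)]
    calc D * d * K ^ 2 = D * (K ^ 2 * d) := by ring
      _ ≤ N * (T ^ 2 * (θ * γ)) := by gcongr
      _ ≤ N * (T ^ 2 * (N * γ)) := by gcongr
      _ = T ^ 2 * N ^ 2 * γ := by ring
  have e3 : √(D / γ) ≤ T * (N / K) := by
    refine le_trans ?_ e2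
    rw [← Real.sqrt_mul hD0, mul_div_assoc']
    gcongr
    nlinarith
  have hFT : F ≤ T * (2 * N / K) := by
    calc F ≤ T * (N / K) + T * (N / K) := by linarith
      _ = T * (2 * N / K) := by ring
  have hXT : (Rb.mat * (chiSchur σ.eig (σ.deviation (avgMat ρ)) *
      chiSchur σ.eig (σ.deviation (avgMat ρ)))).trace.re ≤ T * (2 * N ^ 2 / K) := by
    calc _ ≤ D * 1 + D * √(D / γ) := by linarith
      _ ≤ N * (T * (N / K)) + N * (T * (N / K)) := by
          gcongr
          exact hd0.trans e1
      _ = T * (2 * N ^ 2 / K) := by ring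
  -- the bias
  have hb0 : 0 ≤ ∑ s, (chiNorm σ.eig ((ρ s).inBasis σ).mat - 1) := by
    refine Finset.sum_nonneg fun s _ => ?_
    rw [State.chiNorm_eq _ hq0 σ.eig_sum ((ρ s).inBasis_eq_add σ)]
    linarith [chiNorm_nonneg hq0 (σ.deviation (ρ s).mat)]
  have hb1 : ∑ s, (chiNorm σ.eig ((ρ s).inBasis σ).mat - 1) ≤ T * F := by
    rw [hFdef, hRb, ← sum_invTrace_inBasis hT]
    refine Finset.sum_le_sum fun s _ => ?_
    linarith [((ρ s).inBasis σ).chiNorm_le_invTrace hq0]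
  refine ⟨?_, ?_, ?_⟩
  · rw [trace_observableM hT ρ σ hq0, ← hD]
    have : ((T : ℝ) ^ 2)⁻¹ * ∑ s, (chiNorm σ.eig ((ρ s).inBasis σ).mat - 1) ≤ 2 * N / K := by
      rw [inv_mul_le_iff₀ (by positivity)]
      calc _ ≤ T * F := hb1
        _ ≤ T * (T * (2 * N / K)) := by gcongr
        _ = _ := by ring
    linarith
  · rw [trace_observableM hT ρ σ hq0, ← hD]
    have : 0 ≤ ((T : ℝ) ^ 2)⁻¹ * ∑ s, (chiNorm σ.eig ((ρ s).inBasis σ).mat - 1) :=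
      mul_nonneg (by positivity) hb0
    linarith
  · rw [variance_observableM hT, inv_mul_le_iff₀ (by positivity)]
    have hV := variance_sumOp_le hT ρ σ hq0 hΔ hH
    rw [← hRb, ← hFdef] at hV
    calc _ ≤ _ := hV
      _ ≤ 8 * T ^ 3 * (T * (2 * N ^ 2 / K)) + 10 * T ^ 2 * (T * (2 * N / K)) ^ 2 := by gcongr
      _ = T ^ 4 * (16 * N ^ 2 / K + 40 / K * (N ^ 2 / K)) := by
          field_simp
          ring
      _ ≤ T ^ 4 * (16 * N ^ 2 / K + 1 * (N ^ 2 / K)) := by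
          gcongr
          rw [div_le_one hK0]
          exact hK
      _ = T ^ 4 * (17 * N ^ 2 / K) := by ring

theorem State.dim_pos {d : ℕ} (σ : State d) : 1 ≤ d := by
  rcases Nat.eq_zero_or_pos d with h | h
  · subst h
    have := σ.trace_one
    simp [Matrix.trace] at this
  · exact h

theorem State.minEig_le {d : ℕ} (σ : State d) (i : Fin d) : σ.minEig ≤ σ.eig i :=
  ciInf_le (Set.finite_range _).bddBelow i

/-- A finite sample size satisfies the requirement only if `θ` and the smallest eigenvalue are
positive. -/
theorem sample_size {d T : ℕ} (σ : State d) {θ : ℝ} (hθ : 0 ≤ θ) {K : ℝ≥0} (hK : 0 < K)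
    (h : (K : ℝ≥0∞) * max ((d : ℝ≥0∞) / ENNReal.ofReal θ)
      (ENNReal.ofReal √(d : ℝ) / ENNReal.ofReal √(θ * σ.minEig)) ≤ (T : ℝ≥0∞)) :
    0 < θ ∧ 0 < σ.minEig ∧ (K : ℝ) * d ≤ T * θ ∧ (K : ℝ) ^ 2 * d ≤ T ^ 2 * (θ * σ.minEig) := by
  have hd : (0 : ℝ) < d := by exact_mod_cast σ.dim_pos
  have hKne : (K : ℝ≥0∞) ≠ 0 := by exact_mod_cast hK.ne'
  have key : ∀ x y : ℝ, 0 < x → (K : ℝ≥0∞) * (ENNReal.ofReal x / ENNReal.ofReal y) ≤ (T : ℝ≥0∞) →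
      0 < y ∧ (K : ℝ) * x ≤ T * y := by
    intro x y hx hxy
    have hy : 0 < y := by
      by_contra hy
      rw [ENNReal.ofReal_of_nonpos (not_lt.mp hy),
        ENNReal.div_zero (ENNReal.ofReal_pos.mpr hx).ne', ENNReal.mul_top hKne] at hxy
      exact ENNReal.natCast_ne_top T (top_le_iff.mp hxy)
    refine ⟨hy, ?_⟩
    rw [← ENNReal.ofReal_div_of_pos hy, ← ENNReal.ofReal_coe_nnreal,
      ← ENNReal.ofReal_mul K.coe_nonneg, ← ENNReal.ofReal_natCast,
      ENNReal.ofReal_le_ofReal_iff (Nat.cast_nonneg T), mul_div_assoc', div_le_iff₀ hy] at hxy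
    exact hxy
  have ha := key d θ hd (by
    rw [ENNReal.ofReal_natCast]
    exact le_trans (mul_le_mul_right (le_max_left _ _) _) h)
  have hb := key √d √(θ * σ.minEig) (Real.sqrt_pos.mpr hd)
    (le_trans (mul_le_mul_right (le_max_right _ _) _) h)
  have hθγ := Real.sqrt_pos.mp hb.1
  refine ⟨ha.1, pos_of_mul_pos_right hθγ hθ, ha.2, ?_⟩
  have := pow_le_pow_left₀ (by positivity) hb.2 2
  rwa [mul_pow, mul_pow, Real.sq_sqrt hd.le, Real.sq_sqrt hθγ.le] at this

/-- The tolerant test by measuring `M`: mean and variance of `M`, and Chebyshev's inequality. -/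
theorem measureProb_observableM {d T : ℕ} (σ : State d) {θ : ℝ} (hθ : 0 ≤ θ) {K : ℝ≥0}
    (hK : 10 ^ 9 ≤ K)
    (h : (K : ℝ≥0∞) * max ((d : ℝ≥0∞) / ENNReal.ofReal θ)
      (ENNReal.ofReal √(d : ℝ) / ENNReal.ofReal √(θ * σ.minEig)) ≤ (T : ℝ≥0∞))
    (ρ : Fin T → State d) :
    (buresChiSq (avgMat ρ) σ ≤ ENNReal.ofReal (0.99 * θ) →
      0.99 ≤ measureProb (observableM_herm σ T) (prodState ρ) (Set.Iio (0.995 * θ))) ∧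
    (ENNReal.ofReal θ < buresChiSq (avgMat ρ) σ →
      0.99 ≤ measureProb (observableM_herm σ T) (prodState ρ) (Set.Ici (0.995 * θ))) := by
  have hK0 : 0 < K := lt_of_lt_of_le (by norm_num) hK
  obtain ⟨hθ0, hγ, h1, h2⟩ := sample_size σ hθ hK0 h
  have hK' : (10 : ℝ) ^ 9 ≤ K := by exact_mod_cast hK
  have hKr : (0 : ℝ) < K := by exact_mod_cast hK0
  have hd : (0 : ℝ) < d := by exact_mod_cast σ.dim_pos
  have hT : T ≠ 0 := by
    rintro rfl
    have : (0 : ℝ) < K * d := by positivity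
    simp at h1
    linarith
  have hq0 : ∀ i, 0 < σ.eig i := fun i => hγ.trans_le (σ.minEig_le i)
  have hmom := fun N => observableM_moments (N := N) hT ρ σ hγ σ.minEig_le hθ0
    (le_trans (by norm_num) hK') σ.dim_pos h1 h2
  rw [buresChiSq_eq_chiNorm _ σ hq0]
  set D := chiNorm σ.eig (σ.deviation (avgMat ρ))
  set m := (prodState ρ * observableM σ T).trace.re with hm
  constructor
  · intro hD
    rw [ENNReal.ofReal_le_ofReal_iff (by positivity)] at hD
    obtain ⟨-, hm1, hV⟩ := hmom θ le_rfl (by linarith)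
    -- the mean is at most `0.99 θ`, so the gap to the threshold is `0.005 θ`
    refine measureProb_ge _ (prodState_posSemidef ρ) (trace_prodState ρ)
      (g := 0.005 * θ) (by positivity) (fun x hx => ?_) (hV.trans ?_)
    · rw [Set.mem_Iio, not_lt] at hx
      refine le_trans ?_ (le_abs_self _)
      linarith
    · rw [div_le_iff₀ hKr]
      nlinarith [sq_nonneg θ]
  · intro hD
    have hDθ : θ < D := (ENNReal.ofReal_lt_ofReal_iff'.mp hD).1
    have hD0 : 0 < D := hθ0.trans hDθ
    obtain ⟨hm1, -, hV⟩ := hmom D hDθ.le le_rfl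
    have hb : 2 * D / K ≤ 0.001 * D := by
      rw [div_le_iff₀ hKr]
      nlinarith
    -- the mean is at least `0.999 D` and the threshold at most `0.995 D`
    refine measureProb_ge _ (prodState_posSemidef ρ) (trace_prodState ρ)
      (g := 0.004 * D) (by positivity) (fun x hx => ?_) (hV.trans ?_)
    · rw [Set.mem_Ici, not_le] at hx
      refine le_trans ?_ (neg_le_abs _)
      linarith
    · rw [div_le_iff₀ hKr]
      nlinarith [sq_nonneg D]

/-! ### The trace norm -/

theorem re_trace_mul_nonneg {n : Type*} [Fintype n] [DecidableEq n] {A B : Matrix n n ℂ}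
    (hA : A.PosSemidef) (hB : B.PosSemidef) : 0 ≤ (A * B).trace.re := by
  obtain ⟨C, rfl⟩ := exists_eq_conjTranspose_mul_self hA
  have h := (hB.mul_mul_conjTranspose_same C).trace_nonneg
  rw [Matrix.mul_assoc, Matrix.trace_mul_comm, Matrix.mul_assoc, Matrix.trace_mul_comm] at h
  exact (Complex.le_def.mp h).1

/-- The adjoint of the partial isometry of the polar decomposition: a contraction that attains the
trace norm. -/
theorem exists_contraction_schattenOne {d : ℕ} (A : Matrix (Fin d) (Fin d) ℂ) :
    ∃ U : Matrix (Fin d) (Fin d) ℂ, (1 - Uᴴ * U).PosSemidef ∧ (1 - U * Uᴴ).PosSemidef ∧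
      schattenOne A = (U * A).trace.re := by
  have hH := Matrix.isHermitian_conjTranspose_mul_self A
  set W := (hH.eigenvectorUnitary : Matrix (Fin d) (Fin d) ℂ) with hW
  set μ := hH.eigenvalues with hμ
  have hW1 : W * Wᴴ = 1 := Unitary.mul_star_self_of_mem hH.eigenvectorUnitary.2
  have hW2 : Wᴴ * W = 1 := Unitary.star_mul_self_of_mem hH.eigenvectorUnitary.2
  have hμ0 : ∀ i, 0 ≤ μ i := (Matrix.posSemidef_conjTranspose_mul_self A).eigenvalues_nonneg
  have hspec : Aᴴ * A = W * Matrix.diagonal (fun i => (μ i : ℂ)) * Wᴴ := by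
    have := hH.spectral_theorem
    rw [Unitary.conjStarAlgAut_apply] at this
    exact this
  set B := A * W with hB
  have hBB : Bᴴ * B = Matrix.diagonal (fun i => (μ i : ℂ)) := by
    calc Bᴴ * B = Wᴴ * (Aᴴ * A) * W := by
          rw [hB, Matrix.conjTranspose_mul]
          simp only [Matrix.mul_assoc]
      _ = (Wᴴ * W) * Matrix.diagonal (fun i => (μ i : ℂ)) * (Wᴴ * W) := by
          rw [hspec]
          simp only [Matrix.mul_assoc]
      _ = _ := by rw [hW2, Matrix.one_mul, Matrix.mul_one]
  set r : Fin d → ℝ := fun i => (√(μ i))⁻¹ with hr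
  set R : Matrix (Fin d) (Fin d) ℂ := Matrix.diagonal (fun i => (r i : ℂ)) with hR
  have hRH : Rᴴ = R := by
    rw [hR, Matrix.diagonal_conjTranspose]
    congr 1
    ext i
    simp
  have hrμ : ∀ i, r i * μ i = √(μ i) := by
    intro i
    by_cases h : √(μ i) = 0
    · simp [hr, h]
    · simp only [hr]
      field_simp
      rw [Real.sq_sqrt (hμ0 i)]
  -- `r i` is zero where `μ i` is, so `W R Wᴴ` is the pseudo-inverse of the square root of `Aᴴ A`
  refine ⟨W * R * Bᴴ, ?_, ?_, ?_⟩
  · -- `Uᴴ U` is a projection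
    set Q := (W * R * Bᴴ)ᴴ * (W * R * Bᴴ) with hQ
    have hQ1 : Q = B * (R * R) * Bᴴ := by
      calc Q = B * R * (Wᴴ * W) * R * Bᴴ := by
            rw [hQ]
            simp only [Matrix.conjTranspose_mul, Matrix.conjTranspose_conjTranspose, hRH,
              Matrix.mul_assoc]
        _ = _ := by rw [hW2, Matrix.mul_one, Matrix.mul_assoc B]
    have hQQ : Q * Q = Q := by
      calc Q * Q = B * (R * R * (Bᴴ * B) * (R * R)) * Bᴴ := by
            rw [hQ1]
            simp only [Matrix.mul_assoc]
        _ = B * (R * R) * Bᴴ := by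
            congr 2
            rw [hBB, hR, Matrix.diagonal_mul_diagonal, Matrix.diagonal_mul_diagonal,
              Matrix.diagonal_mul_diagonal]
            congr 1
            ext i
            norm_cast
            by_cases h : √(μ i) = 0
            · simp [hr, h]
            · have h1 : r i * r i * μ i = 1 := by
                rw [mul_assoc, hrμ]
                exact inv_mul_cancel₀ h
              rw [h1, one_mul]
        _ = Q := hQ1.symm
    have hQH : Qᴴ = Q := by
      rw [hQ, Matrix.conjTranspose_mul, Matrix.conjTranspose_conjTranspose]
    have : 1 - Q = (1 - Q)ᴴ * (1 - Q) := by
      rw [Matrix.conjTranspose_sub, Matrix.conjTranspose_one, hQH, Matrix.mul_sub, Matrix.mul_one,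
        Matrix.sub_mul, Matrix.one_mul, hQQ, sub_self, sub_zero]
    rw [this]
    exact Matrix.posSemidef_conjTranspose_mul_self _
  · have h1 : 1 - W * R * Bᴴ * (W * R * Bᴴ)ᴴ =
        W * Matrix.diagonal (fun i => ((1 - r i * μ i * r i : ℝ) : ℂ)) * Wᴴ := by
      have h2 : W * R * Bᴴ * (W * R * Bᴴ)ᴴ = W * (R * (Bᴴ * B) * R) * Wᴴ := by
        simp only [Matrix.conjTranspose_mul, Matrix.conjTranspose_conjTranspose, hRH,
          Matrix.mul_assoc]
      have h3 : Matrix.diagonal (fun i => ((1 - r i * μ i * r i : ℝ) : ℂ)) =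
          1 - R * (Bᴴ * B) * R := by
        rw [hBB, hR, Matrix.diagonal_mul_diagonal, Matrix.diagonal_mul_diagonal,
          ← Matrix.diagonal_one, Matrix.diagonal_sub]
        congr 1
        ext i
        push_cast
        ring
      rw [h2, h3, Matrix.mul_sub, Matrix.sub_mul, Matrix.mul_one, hW1]
    rw [h1]
    refine Matrix.PosSemidef.mul_mul_conjTranspose_same
      (Matrix.PosSemidef.diagonal fun i => ?_) W
    rw [Pi.zero_apply, Complex.zero_le_real, hrμ]
    by_cases h : √(μ i) = 0
    · simp [h]
    · simp [hr, h]
  · have h1 : (W * R * Bᴴ * A).trace = (R * (Bᴴ * B)).trace := by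
      rw [Matrix.mul_assoc, Matrix.mul_assoc, Matrix.trace_mul_comm]
      simp only [hB, Matrix.mul_assoc]
    rw [h1, hBB, hR, Matrix.diagonal_mul_diagonal, Matrix.trace_diagonal, Complex.re_sum,
      schattenOne]
    refine Finset.sum_congr rfl fun i _ => ?_
    rw [← Complex.ofReal_mul, Complex.ofReal_re, hrμ]

/-- Expand `0 ≤ tr (ρ (1 - U)ᴴ (1 - U))`. -/
theorem State.re_trace_contraction_le {d : ℕ} (ρ : State d) {U : Matrix (Fin d) (Fin d) ℂ}
    (hU : (1 - Uᴴ * U).PosSemidef) : (U * ρ.mat).trace.re ≤ 1 := by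
  have h1 := re_trace_mul_nonneg ρ.psd hU
  have h2 := re_trace_mul_nonneg ρ.psd (Matrix.posSemidef_conjTranspose_mul_self (1 - U))
  have h3 : (ρ.mat * Uᴴ).trace = star (U * ρ.mat).trace := by
    rw [← Matrix.trace_conjTranspose, Matrix.conjTranspose_mul, ρ.herm.eq]
  simp only [Matrix.conjTranspose_sub, Matrix.conjTranspose_one, Matrix.sub_mul, Matrix.mul_sub,
    Matrix.one_mul, Matrix.mul_one, Matrix.trace_sub, Complex.sub_re, ρ.trace_one,
    Complex.one_re, h3, Matrix.trace_mul_comm ρ.mat U, Complex.star_def, Complex.conj_re] at h1 h2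
  linarith

theorem traceDist_le_one {d : ℕ} (ρ σ : State d) : traceDist ρ.mat σ.mat ≤ 1 := by
  obtain ⟨U, hU, -, h⟩ := exists_contraction_schattenOne (ρ.mat - σ.mat)
  have h1 := ρ.re_trace_contraction_le hU
  have h2 := σ.re_trace_contraction_le (U := -U) (by simpa using hU)
  rw [traceDist, h, Matrix.mul_sub, Matrix.trace_sub, Complex.sub_re]
  rw [Matrix.neg_mul, Matrix.trace_neg, Complex.neg_re] at h2
  linarith

/-- Cauchy--Schwarz with the weights `(q i + q j) / 2` and their inverses. -/
theorem sq_re_trace_mul_le_chiNorm {d : ℕ} {q : Fin d → ℝ} (hq : ∀ i, 0 < q i)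
    (hq1 : ∑ i, q i = 1) {U : Matrix (Fin d) (Fin d) ℂ} (hU : (1 - Uᴴ * U).PosSemidef)
    (hU' : (1 - U * Uᴴ).PosSemidef) (Δ : Matrix (Fin d) (Fin d) ℂ) :
    (U * Δ).trace.re ^ 2 ≤ chiNorm q Δ := by
  have hrow : ∀ i, ∑ j, ‖U i j‖ ^ 2 ≤ 1 := by
    intro i
    have h := (Complex.le_def.mp (hU'.diag_nonneg (i := i))).1
    rw [Matrix.sub_apply, Matrix.one_apply_eq, Matrix.mul_apply] at h
    simp only [Matrix.conjTranspose_apply, Complex.star_def, Complex.mul_conj'] at h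
    rw [← Complex.ofReal_one] at h
    norm_cast at h
    simpa using h
  have hcol : ∀ j, ∑ i, ‖U i j‖ ^ 2 ≤ 1 := by
    intro j
    have h := (Complex.le_def.mp (hU.diag_nonneg (i := j))).1
    rw [Matrix.sub_apply, Matrix.one_apply_eq, Matrix.mul_apply] at h
    simp only [Matrix.conjTranspose_apply, Complex.star_def, Complex.conj_mul'] at h
    rw [← Complex.ofReal_one] at h
    norm_cast at h
    simpa using h
  have hw : ∑ i, ∑ j, (q i + q j) / 2 * ‖U i j‖ ^ 2 ≤ 1 := by
    have e : ∑ i, ∑ j, (q i + q j) / 2 * ‖U i j‖ ^ 2 =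
        (1 / 2) * ∑ i, q i * ∑ j, ‖U i j‖ ^ 2 + (1 / 2) * ∑ j, q j * ∑ i, ‖U i j‖ ^ 2 := by
      simp only [Finset.mul_sum]
      rw [Finset.sum_comm (f := fun j i => 1 / 2 * (q j * ‖U i j‖ ^ 2)),
        ← Finset.sum_add_distrib]
      refine Finset.sum_congr rfl fun i _ => ?_
      rw [← Finset.sum_add_distrib]
      exact Finset.sum_congr rfl fun j _ => by ring
    have e1 : ∑ i, q i * ∑ j, ‖U i j‖ ^ 2 ≤ ∑ i, q i :=
      Finset.sum_le_sum fun i _ => mul_le_of_le_one_right (hq i).le (hrow i)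
    have e2 : ∑ j, q j * ∑ i, ‖U i j‖ ^ 2 ≤ ∑ i, q i :=
      Finset.sum_le_sum fun i _ => mul_le_of_le_one_right (hq i).le (hcol i)
    rw [e]
    linarith
  have hpos : ∀ i j, 0 < (q i + q j) / 2 := fun i j => by
    have := hq i
    have := hq j
    positivity
  have hle : |(U * Δ).trace.re| ≤ ∑ p : Fin d × Fin d,
      (√((q p.1 + q p.2) / 2) * ‖U p.1 p.2‖) * (√(chiWeight q p.1 p.2) * ‖Δ p.2 p.1‖) := by
    refine (Complex.abs_re_le_norm _).trans ?_
    rw [Fintype.sum_prod_type]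
    simp only [Matrix.trace, Matrix.diag_apply, Matrix.mul_apply]
    refine (norm_sum_le _ _).trans (Finset.sum_le_sum fun i _ =>
      (norm_sum_le _ _).trans (Finset.sum_le_sum fun j _ => le_of_eq ?_))
    have : √((q i + q j) / 2) * √(chiWeight q i j) = 1 := by
      rw [← Real.sqrt_mul (hpos i j).le, chiWeight, mul_inv_cancel₀ (hpos i j).ne', Real.sqrt_one]
    rw [norm_mul]
    linear_combination (-‖U i j‖ * ‖Δ j i‖) * this
  have hcs := Finset.sum_mul_sq_le_sq_mul_sq (Finset.univ : Finset (Fin d × Fin d))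
    (fun p => √((q p.1 + q p.2) / 2) * ‖U p.1 p.2‖)
    (fun p => √(chiWeight q p.1 p.2) * ‖Δ p.2 p.1‖)
  have f1 : ∑ p : Fin d × Fin d, (√((q p.1 + q p.2) / 2) * ‖U p.1 p.2‖) ^ 2 ≤ 1 := by
    rw [Fintype.sum_prod_type]
    refine le_trans (le_of_eq ?_) hw
    refine Finset.sum_congr rfl fun i _ => Finset.sum_congr rfl fun j _ => ?_
    rw [mul_pow, Real.sq_sqrt (hpos i j).le]
  have f2 : ∑ p : Fin d × Fin d, (√(chiWeight q p.1 p.2) * ‖Δ p.2 p.1‖) ^ 2 = chiNorm q Δ := by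
    rw [Fintype.sum_prod_type, Finset.sum_comm]
    refine Finset.sum_congr rfl fun i _ => Finset.sum_congr rfl fun j _ => ?_
    rw [mul_pow, Real.sq_sqrt (chiWeight_pos hq _ _).le, chiWeight_comm]
  rw [f2] at hcs
  calc (U * Δ).trace.re ^ 2 = |(U * Δ).trace.re| ^ 2 := (sq_abs _).symm
    _ ≤ _ := pow_le_pow_left₀ (abs_nonneg _) hle 2
    _ ≤ _ := hcs
    _ ≤ 1 * chiNorm q Δ := mul_le_mul_of_nonneg_right f1 (chiNorm_nonneg hq Δ)
    _ = chiNorm q Δ := one_mul _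

/-- The Bures chi-squared divergence dominates the square of the trace norm. The scaling factor
spares a separate proof that the trace norm is homogeneous. -/
theorem sq_schattenOne_le {d : ℕ} (σ : State d) (hq : ∀ i, 0 < σ.eig i)
    (ρ A : Matrix (Fin d) (Fin d) ℂ) {c : ℝ} (hA : ρ - σ.mat = (c : ℂ) • A) :
    (c * schattenOne A) ^ 2 ≤ chiNorm σ.eig (σ.deviation ρ) := by
  obtain ⟨U, hU, hU', h⟩ := exists_contraction_schattenOne A
  have e1 : (σ.basisᴴ * U * σ.basis)ᴴ = σ.basisᴴ * Uᴴ * σ.basis := by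
    simp only [Matrix.conjTranspose_mul, Matrix.conjTranspose_conjTranspose, Matrix.mul_assoc]
  have e2 : ∀ X Y : Matrix (Fin d) (Fin d) ℂ,
      (σ.basisᴴ * X * σ.basis) * (σ.basisᴴ * Y * σ.basis) = σ.basisᴴ * (X * Y) * σ.basis := by
    intro X Y
    calc _ = σ.basisᴴ * X * (σ.basis * σ.basisᴴ) * Y * σ.basis := by
          simp only [Matrix.mul_assoc]
      _ = _ := by
          rw [σ.basis_mul_conjTranspose, Matrix.mul_one]
          simp only [Matrix.mul_assoc]
  have e3 : ∀ X : Matrix (Fin d) (Fin d) ℂ,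
      1 - σ.basisᴴ * X * σ.basis = σ.basisᴴ * (1 - X) * σ.basis := by
    intro X
    rw [Matrix.mul_sub, Matrix.sub_mul, Matrix.mul_one, σ.conjTranspose_mul_basis]
  have key := sq_re_trace_mul_le_chiNorm hq σ.eig_sum (U := σ.basisᴴ * U * σ.basis)
    (by rw [e1, e2, e3]; exact hU.conjTranspose_mul_mul_same _)
    (by rw [e1, e2, e3]; exact hU'.conjTranspose_mul_mul_same _) (σ.deviation ρ)
  have e4 : (σ.basisᴴ * U * σ.basis * σ.deviation ρ).trace.re = c * schattenOne A := by
    rw [State.deviation, e2, Matrix.trace_mul_comm, ← Matrix.mul_assoc,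
      σ.basis_mul_conjTranspose, Matrix.one_mul, hA, Matrix.mul_smul, Matrix.trace_smul,
      smul_eq_mul, Complex.re_ofReal_mul, h]
  rwa [e4] at key

/-! ### Depolarization of the copies -/

/-- The half-depolarized state `ρ / 2 + 1 / (2 d)`. -/
def State.mix {d : ℕ} (ρ : State d) : State d where
  mat := (2 : ℂ)⁻¹ • ρ.mat + (2 * d : ℂ)⁻¹ • 1
  psd := by
    refine (ρ.psd.smul ?_).add (Matrix.PosSemidef.one.smul ?_)
    · simp
    · simpa using Complex.zero_le_real.mpr (by positivity : (0 : ℝ) ≤ (2 * d : ℝ)⁻¹)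
  trace_one := by
    have hd : (d : ℂ) ≠ 0 := by exact_mod_cast (Nat.one_le_iff_ne_zero.mp ρ.dim_pos)
    simp only [Matrix.trace_add, Matrix.trace_smul, ρ.trace_one, Matrix.trace_one, Fintype.card_fin,
      smul_eq_mul]
    field_simp
    norm_num

theorem State.le_eig_mix {d : ℕ} (σ : State d) (i : Fin d) : (2 * d : ℝ)⁻¹ ≤ σ.mix.eig i := by
  have h1 : (σ.mix.inBasis σ.mix).mat =
      (2 : ℂ)⁻¹ • (σ.inBasis σ.mix).mat + (2 * d : ℂ)⁻¹ • 1 := by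
    change σ.mix.basisᴴ * ((2 : ℂ)⁻¹ • σ.mat + (2 * d : ℂ)⁻¹ • 1) * σ.mix.basis =
      (2 : ℂ)⁻¹ • (σ.mix.basisᴴ * σ.mat * σ.mix.basis) + (2 * d : ℂ)⁻¹ • 1
    rw [Matrix.mul_add, Matrix.add_mul, Matrix.mul_smul, Matrix.smul_mul, Matrix.mul_smul,
      Matrix.smul_mul, Matrix.mul_one, σ.mix.conjTranspose_mul_basis]
  rw [State.inBasis_self] at h1
  have h2 := congrFun (congrFun h1 i) i
  rw [Matrix.diagonal_apply_eq, Matrix.add_apply, Matrix.smul_apply, Matrix.smul_apply,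
    Matrix.one_apply_eq, ← State.ofReal_diag] at h2
  simp only [smul_eq_mul, mul_one] at h2
  have h3 : σ.mix.eig i = 2⁻¹ * (σ.inBasis σ.mix).diag i + (2 * d : ℝ)⁻¹ := by
    apply Complex.ofReal_injective
    rw [h2]
    push_cast
    rfl
  rw [h3]
  linarith [(σ.inBasis σ.mix).diag_nonneg i]

theorem State.le_minEig_mix {d : ℕ} (σ : State d) : (2 * d : ℝ)⁻¹ ≤ σ.mix.minEig := by
  have : Nonempty (Fin d) := ⟨⟨0, σ.dim_pos⟩⟩
  exact le_ciInf σ.le_eig_mix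

theorem avgMat_mix_sub {d T : ℕ} (hT : T ≠ 0) (ρ : Fin T → State d) (σ : State d) :
    avgMat (fun t => (ρ t).mix) - σ.mix.mat = (2 : ℂ)⁻¹ • (avgMat ρ - σ.mat) := by
  have hT' : (T : ℂ) ≠ 0 := by exact_mod_cast hT
  simp only [avgMat, State.mix, Finset.sum_add_distrib, Finset.sum_const, Finset.card_univ,
    Fintype.card_fin, smul_add, smul_sub, ← Finset.smul_sum, ← Nat.cast_smul_eq_nsmul ℂ,
    smul_smul, inv_mul_cancel_left₀ hT']
  rw [mul_comm]
  abel

/-- Kraus operators of the half-depolarizing channel `ρ ↦ ρ / 2 + tr ρ / (2 d)`. -/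
def mixKraus (d : ℕ) : Option (Fin d × Fin d) → Matrix (Fin d) (Fin d) ℂ
  | none => ((√2)⁻¹ : ℝ) • 1
  | some p => ((√(2 * d))⁻¹ : ℝ) • Matrix.single p.1 p.2 1

theorem sum_mixKraus {d : ℕ} (hd : 1 ≤ d) :
    ∑ k, (mixKraus d k)ᴴ * mixKraus d k = 1 := by
  have hd0 : (d : ℝ) ≠ 0 := by exact_mod_cast Nat.one_le_iff_ne_zero.mp hd
  rw [Fintype.sum_option, Fintype.sum_prod_type]
  simp only [mixKraus, Matrix.conjTranspose_smul, star_trivial, Matrix.conjTranspose_one,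
    Matrix.conjTranspose_single, star_one, Matrix.smul_mul, Matrix.mul_smul,
    smul_smul, Matrix.single_mul_single_same, mul_one, ← Finset.smul_sum, Matrix.sum_single_one,
    Finset.sum_const, Finset.card_univ, Fintype.card_fin, ← mul_inv,
    Real.mul_self_sqrt zero_le_two, Real.mul_self_sqrt (by positivity : (0 : ℝ) ≤ 2 * d)]
  rw [← Nat.cast_smul_eq_nsmul ℝ, smul_smul, ← add_smul]
  convert one_smul ℝ _
  field_simp
  norm_num

theorem sum_mixKraus_conj {d : ℕ} (ρ : State d) :
    ∑ k, mixKraus d k * ρ.mat * (mixKraus d k)ᴴ = ρ.mix.mat := by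
  have h : ∑ i, ∑ j, Matrix.single i j 1 * ρ.mat * Matrix.single j i 1 = 1 := by
    rw [Finset.sum_comm]
    simp only [Matrix.single_mul_mul_single, one_mul, mul_one, Matrix.sum_single_eq_diagonal]
    rw [← Matrix.diagonal_one]
    ext x y
    by_cases hxy : x = y
    · subst hxy
      simpa [Matrix.sum_apply, Matrix.trace] using ρ.trace_one
    · simp [Matrix.sum_apply, hxy]
  rw [Fintype.sum_option, Fintype.sum_prod_type]
  simp only [mixKraus, Matrix.conjTranspose_smul, star_trivial, Matrix.conjTranspose_one,
    Matrix.conjTranspose_single, star_one, Matrix.smul_mul, Matrix.mul_smul, Matrix.mul_one,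
    Matrix.one_mul, smul_smul, ← Finset.smul_sum, h, ← mul_inv,
    Real.mul_self_sqrt zero_le_two, Real.mul_self_sqrt (by positivity : (0 : ℝ) ≤ 2 * d)]
  ext x y
  simp [State.mix]

/-- The effect of a measurement of `P` after the channel with Kraus operators `A k` is applied to
each tensor component. -/
def pullback {d T : ℕ} {κ : Type*} [Fintype κ] (A : κ → Matrix (Fin d) (Fin d) ℂ) (P : Op d T) :
    Op d T :=
  ∑ k : Fin T → κ, (tens fun t => A (k t))ᴴ * P * tens fun t => A (k t)

theorem sum_tens {d T : ℕ} {κ : Type*} [Fintype κ] [DecidableEq κ]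
    (B : Fin T → κ → Matrix (Fin d) (Fin d) ℂ) :
    ∑ k : Fin T → κ, tens (fun t => B t (k t)) = tens fun t => ∑ a, B t a := by
  ext x y
  simp only [tens, Matrix.sum_apply, Matrix.of_apply, Finset.prod_univ_sum, Fintype.piFinset_univ]

theorem pullback_posSemidef {d T : ℕ} {κ : Type*} [Fintype κ]
    (A : κ → Matrix (Fin d) (Fin d) ℂ) {P : Op d T} (hP : P.PosSemidef) :
    (pullback A P).PosSemidef :=
  Matrix.posSemidef_sum _ fun _ _ => hP.conjTranspose_mul_mul_same _

theorem pullback_sub {d T : ℕ} {κ : Type*} [Fintype κ]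
    (A : κ → Matrix (Fin d) (Fin d) ℂ) (P Q : Op d T) :
    pullback A (P - Q) = pullback A P - pullback A Q := by
  simp only [pullback, Matrix.mul_sub, Matrix.sub_mul, Finset.sum_sub_distrib]

theorem pullback_one {d T : ℕ} {κ : Type*} [Fintype κ] [DecidableEq κ]
    {A : κ → Matrix (Fin d) (Fin d) ℂ} (hA : ∑ k, (A k)ᴴ * A k = 1) :
    pullback A (1 : Op d T) = 1 := by
  simp only [pullback, Matrix.mul_one, tens_conjTranspose, tens_mul]
  have := sum_tens (T := T) fun _ k => (A k)ᴴ * A k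
  simp only [hA] at this
  exact this.trans tens_one

theorem trace_prodState_mul_pullback {d T : ℕ} {κ : Type*} [Fintype κ] [DecidableEq κ]
    {A : κ → Matrix (Fin d) (Fin d) ℂ} {ρ ρ' : Fin T → State d}
    (h : ∀ t, ∑ k, A k * (ρ t).mat * (A k)ᴴ = (ρ' t).mat) (P : Op d T) :
    (prodState ρ * pullback A P).trace = (prodState ρ' * P).trace := by
  have h1 : prodState ρ' = ∑ k : Fin T → κ,
      (tens fun t => A (k t)) * prodState ρ * (tens fun t => A (k t))ᴴ := by
    simp only [prodState_eq_tens, tens_conjTranspose, tens_mul, ← h]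
    exact (sum_tens fun t k => A k * (ρ t).mat * (A k)ᴴ).symm
  rw [h1, pullback, Finset.mul_sum, Finset.sum_mul, Matrix.trace_sum, Matrix.trace_sum]
  refine Finset.sum_congr rfl fun k _ => ?_
  rw [← Matrix.mul_assoc, Matrix.trace_mul_comm]
  simp only [Matrix.mul_assoc]

/-! ### The certification test -/

theorem spectralProj_posSemidef {d T : ℕ} {A : Op d T} (hA : A.IsHermitian) (S : Set ℝ) :
    (spectralProj hA S).PosSemidef := by
  rw [spectralProj_eq]
  refine Matrix.PosSemidef.mul_mul_conjTranspose_same (Matrix.PosSemidef.diagonal fun k => ?_) _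
  rw [Pi.zero_apply, Complex.zero_le_real]
  exact Set.indicator_nonneg (fun _ _ => zero_le_one) _

theorem one_sub_spectralProj {d T : ℕ} {A : Op d T} (hA : A.IsHermitian) (S : Set ℝ) :
    1 - spectralProj hA S = spectralProj hA Sᶜ := by
  have hU : (hA.eigenvectorUnitary : Op d T) * (hA.eigenvectorUnitary : Op d T)ᴴ = 1 :=
    Unitary.mul_star_self_of_mem hA.eigenvectorUnitary.2
  rw [sub_eq_iff_eq_add, spectralProj, spectralProj, ← Matrix.add_mul, ← Matrix.mul_add,
    Matrix.diagonal_add, ← hU]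
  congr 1
  conv_lhs => rw [← Matrix.mul_one (hA.eigenvectorUnitary : Op d T), ← Matrix.diagonal_one]
  congr 2
  ext k
  by_cases h : hA.eigenvalues k ∈ S <;> simp [h]

/-- The test: depolarize each copy by half, measure the observable of the depolarized `σ`, and
answer "far" if the outcome is at least `0.995 θ`. -/
def mixTest {d : ℕ} (T : ℕ) (σ : State d) (θ : ℝ) : BinaryTest d T where
  far := pullback (mixKraus d) (spectralProj (observableM_herm σ.mix T) (Set.Ici (0.995 * θ)))
  far_nonneg := pullback_posSemidef _ (spectralProj_posSemidef _ _)
  far_le_one := by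
    rw [← pullback_one (sum_mixKraus σ.dim_pos), ← pullback_sub, one_sub_spectralProj]
    exact pullback_posSemidef _ (spectralProj_posSemidef _ _)

theorem probFar_mixTest {d T : ℕ} (σ : State d) (θ : ℝ) (ρ : Fin T → State d) :
    (mixTest T σ θ).probFar (prodState ρ) =
      measureProb (observableM_herm σ.mix T) (prodState fun t => (ρ t).mix)
        (Set.Ici (0.995 * θ)) := by
  rw [BinaryTest.probFar, measureProb, mixTest,
    trace_prodState_mul_pullback fun t => sum_mixKraus_conj (ρ t)]

theorem probClose_mixTest {d T : ℕ} (σ : State d) (θ : ℝ) (ρ : Fin T → State d) :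
    (mixTest T σ θ).probClose (prodState ρ) =
      measureProb (observableM_herm σ.mix T) (prodState fun t => (ρ t).mix)
        (Set.Iio (0.995 * θ)) := by
  rw [BinaryTest.probClose, measureProb, mixTest, ← pullback_one (sum_mixKraus σ.dim_pos),
    ← pullback_sub, trace_prodState_mul_pullback fun t => sum_mixKraus_conj (ρ t),
    one_sub_spectralProj, Set.compl_Ici]

/-- The test that always answers "close". -/
def trivialTest (d T : ℕ) : BinaryTest d T where
  far := 0
  far_nonneg := Matrix.PosSemidef.zero
  far_le_one := by
    rw [sub_zero]
    exact Matrix.PosSemidef.one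

/-- The half-depolarized `σ` has smallest eigenvalue at least `1 / (2 d)`, so the tolerant test
with `θ = ε ^ 2` applies to it; depolarization halves the deviation. For `ε ≥ 1` no state is
`ε`-far from `σ`. -/
theorem exists_binaryTest {d T : ℕ} (σ : State d) {ε : ℝ} (hε : 0 < ε)
    (h : 2 * 10 ^ 9 * ((d : ℝ) / ε ^ 2) ≤ T) :
    ∃ E : BinaryTest d T, ∀ ρ : Fin T → State d,
      (avgMat ρ = σ.mat → 0.99 ≤ E.probClose (prodState ρ)) ∧
      (ε < traceDist (avgMat ρ) σ.mat → 0.99 ≤ E.probFar (prodState ρ)) := by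
  have hd : (1 : ℝ) ≤ d := by exact_mod_cast σ.dim_pos
  have hT : T ≠ 0 := by
    rintro rfl
    have : 0 < 2 * 10 ^ 9 * ((d : ℝ) / ε ^ 2) := by positivity
    simp only [Nat.cast_zero] at h
    linarith
  rcases le_or_gt 1 ε with hε1 | hε1
  · refine ⟨trivialTest d T, fun ρ => ⟨fun _ => ?_, fun hfar => ?_⟩⟩
    · rw [BinaryTest.probClose, trivialTest, sub_zero, Matrix.mul_one, trace_prodState]
      norm_num
    · have := traceDist_le_one (avgState hT ρ) σ
      change traceDist (avgMat ρ) σ.mat ≤ 1 at this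
      linarith
  have hγ := σ.le_minEig_mix
  have hsize : ((10 ^ 9 : ℝ≥0) : ℝ≥0∞) * max ((d : ℝ≥0∞) / ENNReal.ofReal (ε ^ 2))
      (ENNReal.ofReal √(d : ℝ) / ENNReal.ofReal √(ε ^ 2 * σ.mix.minEig)) ≤ (T : ℝ≥0∞) := by
    have hγ0 : 0 < σ.mix.minEig := lt_of_lt_of_le (by positivity) hγ
    have hmax : max ((d : ℝ≥0∞) / ENNReal.ofReal (ε ^ 2))
        (ENNReal.ofReal √(d : ℝ) / ENNReal.ofReal √(ε ^ 2 * σ.mix.minEig)) ≤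
        ENNReal.ofReal (2 * (d / ε ^ 2)) := by
      refine max_le ?_ ?_
      · rw [← ENNReal.ofReal_natCast, ← ENNReal.ofReal_div_of_pos (by positivity)]
        apply ENNReal.ofReal_le_ofReal
        have : 0 ≤ (d : ℝ) / ε ^ 2 := by positivity
        linarith
      · rw [← ENNReal.ofReal_div_of_pos (by positivity)]
        apply ENNReal.ofReal_le_ofReal
        rw [div_le_iff₀ (by positivity)]
        refine Real.sqrt_le_iff.mpr ⟨by positivity, ?_⟩
        rw [mul_pow, Real.sq_sqrt (by positivity)]
        have hε2 : ε ^ 2 ≤ 1 := pow_le_one₀ hε.le hε1.le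
        calc (d : ℝ) ≤ 2 * (d / 1) := by linarith
          _ ≤ 2 * (d / ε ^ 2) := by gcongr
          _ = (2 * (d / ε ^ 2)) ^ 2 * (ε ^ 2 * (2 * d : ℝ)⁻¹) := by
              field_simp
          _ ≤ _ := by gcongr
    refine (mul_le_mul_right hmax _).trans ?_
    rw [← ENNReal.ofReal_coe_nnreal, ← ENNReal.ofReal_mul (NNReal.coe_nonneg _),
      ← ENNReal.ofReal_natCast]
    apply ENNReal.ofReal_le_ofReal
    refine le_trans (le_of_eq ?_) h
    push_cast
    ring
  refine ⟨mixTest T σ (ε ^ 2), fun ρ => ?_⟩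
  have key := measureProb_observableM σ.mix (sq_nonneg ε) le_rfl hsize fun t => (ρ t).mix
  have hsub := avgMat_mix_sub hT ρ σ
  constructor
  · intro heq
    rw [probClose_mixTest]
    refine key.1 ?_
    rw [heq, sub_self, smul_zero] at hsub
    simp [buresChiSq, chiSqDiag, hsub]
  · intro hfar
    rw [probFar_mixTest]
    refine key.2 ?_
    have hq0 : ∀ i, 0 < σ.mix.eig i := fun i => lt_of_lt_of_le (by positivity) (σ.le_eig_mix i)
    rw [buresChiSq_eq_chiNorm _ _ hq0]
    have hn := sq_schattenOne_le σ.mix hq0 (avgMat fun t => (ρ t).mix) (avgMat ρ - σ.mat)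
      (c := 2⁻¹) (by rw [hsub]; norm_num)
    rw [traceDist] at hfar
    have h1 : ε ^ 2 < (2⁻¹ * schattenOne (avgMat ρ - σ.mat)) ^ 2 := by
      refine pow_lt_pow_left₀ ?_ hε.le two_ne_zero
      linarith
    rw [ENNReal.ofReal_lt_ofReal_iff']
    exact ⟨h1.trans_le hn, (pow_pos hε 2).trans (h1.trans_le hn)⟩

end QTest

end

theorem theorem1p6 :
    (∃ K : ℝ≥0, 0 < K ∧
      ∀ (d T : ℕ) (σ : QTest.State d) (θ : ℝ), 0 ≤ θ →
        (K : ℝ≥0∞) * max ((d : ℝ≥0∞) / ENNReal.ofReal θ)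
            (ENNReal.ofReal √(d : ℝ) / ENNReal.ofReal √(θ * σ.minEig)) ≤ (T : ℝ≥0∞) →
        ∀ ρ : Fin T → QTest.State d,
          (QTest.buresChiSq (QTest.avgMat ρ) σ ≤ ENNReal.ofReal (0.99 * θ) →
            0.99 ≤ QTest.measureProb (QTest.observableM_herm σ T) (QTest.prodState ρ)
              (Set.Iio (0.995 * θ))) ∧
          (ENNReal.ofReal θ < QTest.buresChiSq (QTest.avgMat ρ) σ →
            0.99 ≤ QTest.measureProb (QTest.observableM_herm σ T) (QTest.prodState ρ)
              (Set.Ici (0.995 * θ)))) ∧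
    (∃ K : ℝ≥0, 0 < K ∧
      ∀ (d T : ℕ) (σ : QTest.State d) (ε : ℝ), 0 < ε →
        (K : ℝ) * ((d : ℝ) / ε ^ 2) ≤ (T : ℝ) →
        ∃ E : QTest.BinaryTest d T, ∀ ρ : Fin T → QTest.State d,
          (QTest.avgMat ρ = σ.mat → 0.99 ≤ E.probClose (QTest.prodState ρ)) ∧
          (ε < QTest.traceDist (QTest.avgMat ρ) σ.mat →
            0.99 ≤ E.probFar (QTest.prodState ρ))) := by
  refine ⟨⟨10 ^ 9, by norm_num, fun d T σ θ hθ h ρ => QTest.measureProb_observableM σ hθ le_rfl h ρ⟩,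
    ⟨2 * 10 ^ 9, by norm_num, fun d T σ ε hε h => QTest.exists_binaryTest σ hε ?_⟩⟩
  exact_mod_cast h
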